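/- All groups are finite. Let $\mathfrak F$ be a saturated formation (a class of groups, closed under isomorphisms and quotients, such that every group $G$ has a smallest normal subgroup with quotient in $\mathfrak F$, and such that $G/\Phi(G)\in\mathfrak F$ implies $G\in\mathfrak F$) that contains the class $\mathfrak U$ of all supersoluble groups. Call a group $X$ a $ca$-$\mathfrak F$-group if every non-abelian chief factor of $X$ is simple and every abelian chief factor $A/B$ of $X$ is $\mathfrak F$-central, i.e. the semidirect product $(A/B)\rtimes (X/C_X(A/B))$, formed with respect to the action induced by conjugation, belongs to $\mathfrak F$. Let $G=HK$ be the product of subgroups $H$ and $K$ that are mutually permutable, i.e. $H$ permutes with every subgroup of $K$ and $K$ permutes with every subgroup of $H$. Suppose that $H$ and $K$ are $ca$-$\mathfrak F$-groups and that the derived subgroup $G'$ is quasinilpotent, i.e. every element of $G'$ induces an inner automorphism on every chief factor of $G'$. Then $G$ is a $ca$-$\mathfrak F$-group. -/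

import Mathlib

open scoped Pointwise

universe u

/-- A class of finite groups: a collection of finite groups closed under isomorphism. -/
structure FiniteGroupClass where
  /-- `Mem A` says that the group `A` belongs to the class. -/
  Mem : ∀ (A : Type u) [Group A], Prop
  finite_of_mem : ∀ (A : Type u) [Group A], Mem A → Finite A
  mem_of_mulEquiv : ∀ (A B : Type u) [Group A] [Group B], (A ≃* B) → Mem A → Mem B

/-- A formation: a class closed under quotients such that every finite group has a smallest
normal subgroup (the residual) with quotient in the class. -/
structure FiniteGroupClass.IsFormation (F : FiniteGroupClass.{u}) : Prop where
  quotient_mem : ∀ (A : Type u) [Group A] (N : Subgroup A) [N.Normal], F.Mem A → F.Mem (A ⧸ N)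
  exists_residual : ∀ (A : Type u) [Group A] [Finite A],
    ∃ (R : Subgroup A) (_ : R.Normal), F.Mem (A ⧸ R) ∧
      ∀ (N : Subgroup A) [N.Normal], F.Mem (A ⧸ N) → R ≤ N

/-- A saturated formation: it contains each finite group `A` with `A / Φ(A)` in it. -/
structure FiniteGroupClass.IsSaturatedFormation (F : FiniteGroupClass.{u}) : Prop
    extends F.IsFormation where
  saturated : ∀ (A : Type u) [Group A] [Finite A], F.Mem (A ⧸ frattini A) → F.Mem A

section Factors

variable {G : Type u} [Group G]

/-- The factor `H / K`, as a subgroup of `G / K`. -/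
abbrev factorSubgroup (H K : Subgroup G) [K.Normal] : Subgroup (G ⧸ K) :=
  H.map (QuotientGroup.mk' K)

instance factorSubgroup_normal (H K : Subgroup G) [hH : H.Normal] [K.Normal] :
    (factorSubgroup H K).Normal :=
  hH.map _ (QuotientGroup.mk'_surjective K)

/-- The action of `G` on the factor `H / K` by conjugation. -/
noncomputable def factorAction (H K : Subgroup G) [H.Normal] [K.Normal] :
    G →* MulAut (factorSubgroup H K) :=
  MulAut.conjNormal.comp (QuotientGroup.mk' K)

/-- The centralizer `C_G(H / K)`, that is, the kernel of the conjugation action. -/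
noncomputable abbrev factorCentralizer (H K : Subgroup G) [H.Normal] [K.Normal] : Subgroup G :=
  (factorAction H K).ker

/-- The semidirect product of `H / K` with `G / C_G(H / K)`, for the action induced by
conjugation. -/
abbrev FactorSemidirect (H K : Subgroup G) [H.Normal] [K.Normal] : Type u :=
  factorSubgroup H K ⋊[QuotientGroup.kerLift (factorAction H K)] (G ⧸ factorCentralizer H K)

/-- `H / K` is a chief factor of `G` (for normal subgroups `H`, `K` of `G`): `K < H` and no
normal subgroup of `G` lies strictly between `K` and `H`. -/
def IsChiefFactor (H K : Subgroup G) : Prop :=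
  K < H ∧ ∀ L : Subgroup G, L.Normal → K ≤ L → L ≤ H → L = K ∨ L = H

/-- The factor `H / K` is `F`-central in `G`. -/
def FiniteGroupClass.IsCentralFactor (F : FiniteGroupClass.{u}) (H K : Subgroup G)
    [H.Normal] [K.Normal] : Prop :=
  F.Mem (FactorSemidirect H K)

end Factors

/-- A (finite) group is a `ca`-`F`-group if every non-abelian chief factor is simple and every
abelian chief factor is `F`-central. -/
structure FiniteGroupClass.IsCaGroup (F : FiniteGroupClass.{u}) (G : Type u) [Group G] :
    Prop where
  finite : Finite G
  simple_of_nonabelian : ∀ (H K : Subgroup G) [H.Normal] [K.Normal], IsChiefFactor H K →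
    ¬ IsMulCommutative (factorSubgroup H K) → IsSimpleGroup (factorSubgroup H K)
  central_of_abelian : ∀ (H K : Subgroup G) [H.Normal] [K.Normal], IsChiefFactor H K →
    IsMulCommutative (factorSubgroup H K) → F.IsCentralFactor H K

/-- A group is supersoluble if it has a finite series from `1` to `G` of normal subgroups of `G`
with cyclic factors. -/
def IsSupersoluble (G : Type u) [Group G] : Prop :=
  ∃ (n : ℕ) (S : ℕ → Subgroup G) (_ : ∀ i, (S i).Normal), S 0 = ⊥ ∧ S n = ⊤ ∧
    ∀ i < n, S i ≤ S (i + 1) ∧ IsCyclic (factorSubgroup (S (i + 1)) (S i))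

/-- A (finite) group is quasinilpotent if each of its elements induces an inner automorphism on
each of its chief factors. -/
def IsQuasinilpotent (G : Type u) [Group G] : Prop :=
  Finite G ∧ ∀ (H K : Subgroup G) [H.Normal] [K.Normal], IsChiefFactor H K →
    ∀ g : G, ∃ x : factorSubgroup H K, factorAction H K g = MulAut.conj x

/-- `G = HK` is the mutually permutable product of `H` and `K`: `H` permutes with every subgroup
of `K` and `K` permutes with every subgroup of `H`. -/
structure IsMutuallyPermutableProduct {G : Type u} [Group G] (H K : Subgroup G) : Prop where
  mul_eq_univ : (H : Set G) * (K : Set G) = Set.univ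
  left_permutes : ∀ L : Subgroup G, L ≤ K → (H : Set G) * (L : Set G) = (L : Set G) * (H : Set G)
  right_permutes : ∀ L : Subgroup G, L ≤ H → (K : Set G) * (L : Set G) = (L : Set G) * (K : Set G)

/-! Let `A / B` be a chief factor of `G`, and work in `Q = G / B` with the minimal normal subgroup
`N = A / B`. Chief factors of `H`, `K` and `G'` enter as minimal invariant subgroups of homomorphic
images (`exists_chiefFactor_mulEquiv`), so the hypotheses are available in every quotient of `G`.

Suppose that `N` is abelian. Quasinilpotency of `G'` makes `Q'` centralise `N`
(`commutator_centralizes_of_isMinInvariant`), so `Q` acts on `N` through an irreducible abelian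
group `T`, and `N` is a line over a field, by Schur. Each of `H`, `K` leaves invariant a nontrivial
subgroup of `N` on which it acts `F`-centrally (`exists_isConjInvariant_mem`): a minimal one inside
`H ∩ N` if this is nontrivial, and otherwise one of prime order, where supersolubility suffices.
Multiplication in the field pairs these two subgroups `M₀`, `M₁` into `N`, and the products generate
`N`. A Heisenberg-type group extends the direct product of the two semidirect products by `N`, with
`N` inside its Frattini subgroup, so saturation puts it in `F` (`tensor_mem`). A subdirect product
argument then yields `N ⋊ T`.

Suppose that `N` is nonabelian. Elements of `Q'` induce inner automorphisms on `N`, so modulo `C(N)`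
the derived subgroup becomes `N` itself (`map_commutator_centralizer_eq`, `InnerSocle`). Itô's
theorem rules out that `H` and `K` both meet `N` trivially, hence `N = (H ∩ N)(K ∩ N)`. As `N` is
perfect, an argument with the largest prime divisor of its order finds a nontrivial normal subgroup
of `N` inside one of the two factors (`exists_normal_le_of_perfect`). A minimal normal subgroup `W`
of `N` in that factor is simple, and permutability together with the `ca` hypothesis forces `W = N`
(`InnerSocle.eq_of_le_left`). -/

section Library

open scoped commutatorElement

/-! ### Invariant subgroups and permuting subgroups. -/

namespace Subgroup

variable {G : Type*} [Group G]

/-- `M` is invariant under conjugation by the elements of `R`. -/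
def IsConjInvariant (R M : Subgroup G) : Prop :=
  ∀ r ∈ R, ∀ m ∈ M, r * m * r⁻¹ ∈ M

/-- `M` is minimal among the nontrivial subgroups invariant under conjugation by `R`. -/
structure IsMinInvariant (R M : Subgroup G) : Prop where
  ne_bot : M ≠ ⊥
  inv : IsConjInvariant R M
  eq_of_le : ∀ L ≤ M, IsConjInvariant R L → L ≠ ⊥ → L = M

/-- The subgroups `A` and `L` permute. -/
def Permutes (A L : Subgroup G) : Prop :=
  ∀ a ∈ A, ∀ l ∈ L, ∃ l' ∈ L, ∃ a' ∈ A, a * l = l' * a'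

/-- Each of `A`, `B` permutes with every subgroup of the other. -/
structure MutuallyPermutes (A B : Subgroup G) : Prop where
  left : ∀ L ≤ B, Permutes A L
  right : ∀ L ≤ A, Permutes B L

theorem MutuallyPermutes.symm {A B : Subgroup G} (h : MutuallyPermutes A B) :
    MutuallyPermutes B A := ⟨h.right, h.left⟩

theorem Permutes.symm {A L : Subgroup G} (h : Permutes A L) : Permutes L A := by
  intro l hl a ha
  obtain ⟨l', hl', a', ha', e⟩ := h a⁻¹ (inv_mem ha) l⁻¹ (inv_mem hl)
  refine ⟨a'⁻¹, inv_mem ha', l'⁻¹, inv_mem hl', ?_⟩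
  have := congrArg (·⁻¹) e
  simpa using this

theorem Permutes.exists_mul {A L : Subgroup G} (h : Permutes A L) {x : G} (hx : x ∈ A ⊔ L) :
    ∃ a ∈ A, ∃ l ∈ L, x = a * l := by
  rw [sup_eq_closure] at hx
  induction hx using closure_induction with
  | mem x hx =>
    rcases hx with hx | hx
    · exact ⟨x, hx, 1, one_mem _, by simp⟩
    · exact ⟨1, one_mem _, x, hx, by simp⟩
  | one => exact ⟨1, one_mem _, 1, one_mem _, by simp⟩
  | mul x y _ _ hx hy =>
    obtain ⟨a, ha, l, hl, rfl⟩ := hx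
    obtain ⟨a', ha', l', hl', rfl⟩ := hy
    obtain ⟨a₂, ha₂, l₂, hl₂, e⟩ := h.symm l hl a' ha'
    refine ⟨a * a₂, mul_mem ha ha₂, l₂ * l', mul_mem hl₂ hl', ?_⟩
    calc a * l * (a' * l') = a * (l * a') * l' := by group
      _ = _ := by rw [e]; group
  | inv x _ hx =>
    obtain ⟨a, ha, l, hl, rfl⟩ := hx
    obtain ⟨a₂, ha₂, l₂, hl₂, e⟩ := h.symm l⁻¹ (inv_mem hl) a⁻¹ (inv_mem ha)
    exact ⟨a₂, ha₂, l₂, hl₂, by rw [mul_inv_rev, e]⟩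

theorem Permutes.exists_mul' {A L : Subgroup G} (h : Permutes A L) {x : G} (hx : x ∈ A ⊔ L) :
    ∃ l ∈ L, ∃ a ∈ A, x = l * a :=
  h.symm.exists_mul (sup_comm A L ▸ hx)

theorem MutuallyPermutes.permutes {A B : Subgroup G} (h : MutuallyPermutes A B) :
    Permutes A B := h.left B le_rfl

theorem MutuallyPermutes.inf {A B : Subgroup G} (h : MutuallyPermutes A B) (N : Subgroup G) :
    MutuallyPermutes (A ⊓ N) (B ⊓ N) := by
  have key : ∀ {A L : Subgroup G}, Permutes A L → L ≤ N → Permutes (A ⊓ N) L := by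
    intro A L hAL hL a ha l hl
    obtain ⟨l', hl', a', ha', e⟩ := hAL a ha.1 l hl
    refine ⟨l', hl', a', ⟨ha', ?_⟩, e⟩
    have : a' = l'⁻¹ * (a * l) := by rw [e]; group
    rw [this]
    exact N.mul_mem (N.inv_mem (hL hl')) (N.mul_mem ha.2 (hL hl))
  exact ⟨fun L hL => key (h.left L (hL.trans inf_le_left)) (hL.trans inf_le_right),
    fun L hL => key (h.right L (hL.trans inf_le_left)) (hL.trans inf_le_right)⟩

theorem Permutes.map {G' : Type*} [Group G'] {A L : Subgroup G} (h : Permutes A L)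
    (f : G →* G') : Permutes (A.map f) (L.map f) := by
  rintro _ ⟨a, ha, rfl⟩ _ ⟨l, hl, rfl⟩
  obtain ⟨l', hl', a', ha', e⟩ := h a ha l hl
  exact ⟨f l', ⟨l', hl', rfl⟩, f a', ⟨a', ha', rfl⟩, by rw [← map_mul, e, map_mul]⟩

theorem MutuallyPermutes.map {G' : Type*} [Group G'] {A B : Subgroup G}
    (h : MutuallyPermutes A B) (f : G →* G') : MutuallyPermutes (A.map f) (B.map f) := by
  have key : ∀ {A B : Subgroup G}, (∀ L ≤ B, Permutes A L) → ∀ L ≤ B.map f,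
      Permutes (A.map f) L := by
    intro A B h L hL
    have : L = (L.comap f ⊓ B).map f := by
      apply le_antisymm
      · intro x hx
        obtain ⟨b, hb, rfl⟩ := hL hx
        exact ⟨b, ⟨hx, hb⟩, rfl⟩
      · rintro _ ⟨x, hx, rfl⟩
        exact hx.1
    rw [this]
    exact (h _ inf_le_right).map f
  exact ⟨key h.left, key h.right⟩

theorem MutuallyPermutes.subgroupOf {A B N : Subgroup G} (h : MutuallyPermutes A B)
    (hA : A ≤ N) (hB : B ≤ N) : MutuallyPermutes (A.subgroupOf N) (B.subgroupOf N) := by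
  have key : ∀ {A B : Subgroup G}, B ≤ N → A ≤ N → (∀ L ≤ B, Permutes A L) →
      ∀ L ≤ B.subgroupOf N, Permutes (A.subgroupOf N) L := by
    intro A B hB hA h L hL a ha l hl
    have hL' : L.map N.subtype ≤ B := by
      rintro _ ⟨x, hx, rfl⟩
      exact hL hx
    obtain ⟨l', ⟨l'', hl'', rfl⟩, a', ha', e⟩ := h _ hL' a ha l ⟨l, hl, rfl⟩
    exact ⟨l'', hl'', ⟨a', hA ha'⟩, ha', Subtype.ext e⟩
  exact ⟨key hB hA h.left, key hA hB h.right⟩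

theorem IsConjInvariant.mono {R R' M : Subgroup G} (h : IsConjInvariant R M) (hR : R' ≤ R) :
    IsConjInvariant R' M := fun r hr => h r (hR hr)

theorem IsConjInvariant.of_le {R M : Subgroup G} (h : R ≤ M) : IsConjInvariant R M :=
  fun _ hr _ hm => M.mul_mem (M.mul_mem (h hr) hm) (M.inv_mem (h hr))

theorem IsConjInvariant.inf {R M L : Subgroup G} (h : IsConjInvariant R M)
    (h' : IsConjInvariant R L) : IsConjInvariant R (M ⊓ L) :=
  fun r hr m hm => ⟨h r hr m hm.1, h' r hr m hm.2⟩

theorem IsConjInvariant.conj_mem_iff {R M : Subgroup G} (h : IsConjInvariant R M) {r : G}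
    (hr : r ∈ R) {m : G} : r * m * r⁻¹ ∈ M ↔ m ∈ M := by
  refine ⟨fun hm => ?_, h r hr m⟩
  simpa [mul_assoc] using h r⁻¹ (inv_mem hr) _ hm

theorem IsConjInvariant.sup_right {R M L : Subgroup G} (h : IsConjInvariant R M)
    (h' : IsConjInvariant R L) : IsConjInvariant R (M ⊔ L) := by
  intro r hr m hm
  have : M ⊔ L ≤ (M ⊔ L).comap (MulAut.conj r).toMonoidHom :=
    sup_le (fun x hx => mem_sup_left (h r hr x hx)) (fun x hx => mem_sup_right (h' r hr x hx))
  exact this hm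

theorem IsConjInvariant.sup_left {R S M : Subgroup G} (h : IsConjInvariant R M)
    (h' : IsConjInvariant S M) : IsConjInvariant (R ⊔ S) M := by
  have : R ⊔ S ≤ normalizer (M : Set G) := by
    refine sup_le (fun x hx => ?_) (fun x hx => ?_)
    · exact mem_normalizer_iff.mpr fun m => (h.conj_mem_iff hx).symm
    · exact mem_normalizer_iff.mpr fun m => (h'.conj_mem_iff hx).symm
  exact fun r hr m hm => (mem_normalizer_iff.mp (this hr) m).mp hm

theorem isConjInvariant_closure {R : Subgroup G} {s : Set G}
    (h : ∀ r ∈ R, ∀ x ∈ s, r * x * r⁻¹ ∈ closure s) : IsConjInvariant R (closure s) := by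
  intro r hr m hm
  have : closure s ≤ (closure s).comap (MulAut.conj r).toMonoidHom :=
    (closure_le _).mpr fun x hx => h r hr x hx
  exact this hm

theorem isConjInvariant_top_iff {M : Subgroup G} : IsConjInvariant ⊤ M ↔ M.Normal :=
  ⟨fun h => ⟨fun m hm g => h g trivial m hm⟩, fun h g _ m hm => h.conj_mem m hm g⟩

theorem Normal.isConjInvariant {M : Subgroup G} (h : M.Normal) (R : Subgroup G) :
    IsConjInvariant R M := fun g _ m hm => h.conj_mem m hm g

theorem exists_isMinInvariant [Finite G] {R M : Subgroup G} (h : IsConjInvariant R M)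
    (hM : M ≠ ⊥) : ∃ M₀ ≤ M, IsMinInvariant R M₀ := by
  obtain ⟨M₀, h₀⟩ := (Set.toFinite {L : Subgroup G | L ≤ M ∧ IsConjInvariant R L ∧
    L ≠ ⊥}).exists_minimal ⟨M, le_rfl, h, hM⟩
  refine ⟨M₀, h₀.prop.1, h₀.prop.2.2, h₀.prop.2.1, fun L hL hLi hLb => ?_⟩
  exact le_antisymm hL (h₀.le_of_le ⟨hL.trans h₀.prop.1, hLi, hLb⟩ hL)

/-- Two subgroups normalising each other and intersecting trivially commute elementwise. -/
theorem commute_of_inf_eq_bot {M L : Subgroup G} (h : IsConjInvariant M L)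
    (h' : IsConjInvariant L M) (hML : M ⊓ L = ⊥) {m l : G} (hm : m ∈ M) (hl : l ∈ L) :
    m * l = l * m := by
  have h1 : m * l * m⁻¹ * l⁻¹ ∈ M ⊓ L := by
    refine ⟨?_, L.mul_mem (h m hm l hl) (L.inv_mem hl)⟩
    have := M.mul_mem hm (h' l hl _ (M.inv_mem hm))
    simpa [mul_assoc] using this
  rw [hML, mem_bot] at h1
  have := congrArg (· * (l * m)) h1
  simpa [mul_assoc] using this

/-- When `G = BA`, the inclusion of `B` induces a bijection from `B / (A ∩ B)` onto the cosets of
`A`. -/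
theorem relIndex_eq_index_of_exists_mul {A B : Subgroup G} (h : ∀ g : G, ∃ b ∈ B, ∃ a ∈ A,
    g = b * a) : A.relIndex B = A.index := by
  have hf : ∀ x y : B, QuotientGroup.leftRel (A.subgroupOf B) x y →
      QuotientGroup.leftRel A (x : G) (y : G) := by
    intro x y hxy
    rw [QuotientGroup.leftRel_apply] at hxy ⊢
    exact hxy
  refine Nat.card_congr (Equiv.ofBijective
    (Quotient.map' (s₁ := QuotientGroup.leftRel (A.subgroupOf B))
      (s₂ := QuotientGroup.leftRel A) (fun x : B => (x : G)) hf) ⟨?_, ?_⟩)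
  · intro x y
    induction x using QuotientGroup.induction_on with | _ x
    induction y using QuotientGroup.induction_on with | _ y
    intro hxy
    have hxy' : ((x : G) : G ⧸ A) = (y : G) := hxy
    rw [QuotientGroup.eq] at hxy' ⊢
    exact hxy'
  · intro g
    induction g using QuotientGroup.induction_on with | _ g
    obtain ⟨b, hb, a, ha, rfl⟩ := h g
    refine ⟨((⟨b, hb⟩ : B) : B ⧸ A.subgroupOf B), ?_⟩
    change ((b : G) : G ⧸ A) = ((b * a : G) : G ⧸ A)
    rw [QuotientGroup.eq]
    simpa using ha

theorem commutator_le_ker {G' : Type*} [Group G'] (f : G →* G')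
    (h : ∀ x y, f x * f y = f y * f x) : _root_.commutator G ≤ f.ker := by
  rw [_root_.commutator_def, commutator_le]
  intro x _ y _
  rw [MonoidHom.mem_ker, map_commutatorElement, commutatorElement_eq_one_iff_mul_comm]
  exact h x y

end Subgroup

/-! ### Subgroups of small index and elements of prime power order. -/

namespace Subgroup

variable {G : Type*} [Group G]

theorem index_dvd_card_of_exists_mul {A B : Subgroup G} (h : ∀ g : G, ∃ b ∈ B, ∃ a ∈ A,
    g = b * a) : A.index ∣ Nat.card B :=
  relIndex_eq_index_of_exists_mul h ▸ relIndex_dvd_card A B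

/-- An element of `p`-power order lies in each subgroup of index less than `p`. -/
theorem mem_of_pow_eq_one_of_index_lt [Finite G] {Z : Subgroup G} {p : ℕ} (hp : p.Prime)
    (hZ : Z.index < p) {x : G} {k : ℕ} (hx : x ^ p ^ k = 1) : x ∈ Z := by
  -- The core is the kernel of the action on the cosets of `Z`, so its index divides `Z.index!`,
  -- which is prime to `p`.
  have h : Z.normalCore.index ∣ (Z.index).factorial := by
    rw [normalCore_eq_ker, index_ker, index_eq_card, ← Nat.card_perm]
    exact card_subgroup_dvd_card _
  have hc : (Z.normalCore.index).Coprime (p ^ k) := by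
    refine Nat.Coprime.pow_right k ((Nat.Prime.coprime_iff_not_dvd hp).mpr fun hd => ?_).symm
    exact absurd ((hp.dvd_factorial).mp (hd.trans h)) (by omega)
  have h1 : x ^ Z.normalCore.index ∈ Z.normalCore := pow_index_mem _ x
  have h2 : x ^ p ^ k ∈ Z.normalCore := hx ▸ one_mem _
  apply Z.normalCore_le
  have h3 : orderOf (x : G ⧸ Z.normalCore) ∣ 1 := by
    rw [← hc.gcd_eq_one]
    refine Nat.dvd_gcd (orderOf_dvd_of_pow_eq_one ?_) (orderOf_dvd_of_pow_eq_one ?_)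
    · rwa [← QuotientGroup.mk_pow, QuotientGroup.eq_one_iff]
    · rwa [← QuotientGroup.mk_pow, QuotientGroup.eq_one_iff]
  rw [Nat.dvd_one, orderOf_eq_one_iff, QuotientGroup.eq_one_iff] at h3
  exact h3

/-- Permutability writes each element as `b ^ j * a`, so `b ^ i` with `i < s` represent all the
cosets. -/
theorem index_le_of_sup_zpowers_pow [Finite G] {A : Subgroup G} {b : G} {s : ℕ} (hs : 0 < s)
    (h : Permutes A (zpowers b)) :
    ((A ⊔ zpowers (b ^ s)).subgroupOf (A ⊔ zpowers b)).index ≤ s := by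
  set Y := A ⊔ zpowers b
  set Z := A ⊔ zpowers (b ^ s)
  have hb : b ∈ Y := mem_sup_right (mem_zpowers b)
  refine (Nat.card_le_card_of_surjective
    (fun i : Fin s => ((⟨b ^ (i : ℕ), pow_mem hb _⟩ : Y) : Y ⧸ Z.subgroupOf Y)) ?_).trans
    (by simp)
  intro y
  induction y using QuotientGroup.induction_on with | _ y
  obtain ⟨y, hy⟩ := y
  obtain ⟨l, hl, a, ha, rfl⟩ := h.exists_mul' hy
  obtain ⟨j, rfl⟩ := mem_powers_iff_mem_zpowers.mpr hl
  refine ⟨⟨j % s, Nat.mod_lt _ hs⟩, ?_⟩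
  rw [QuotientGroup.eq, mem_subgroupOf]
  have : (b ^ (j % s))⁻¹ * (b ^ j * a) = (b ^ s) ^ (j / s) * a := by
    have e : b ^ j = b ^ (j % s) * (b ^ s) ^ (j / s) := by
      rw [← pow_mul, ← pow_add, Nat.mod_add_div]
    rw [e, mul_assoc, inv_mul_cancel_left]
  change (b ^ (j % s))⁻¹ * (b ^ j * a) ∈ Z
  rw [this]
  exact mul_mem (mem_sup_right (pow_mem (mem_zpowers _) _)) (mem_sup_left ha)

/-- If `A` permutes with the subgroups of `⟨b⟩`, where the order of `b` is prime to the largest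
prime `p` dividing the group order, then `A` contains the `p`-elements of `A⟨b⟩`. -/
theorem mem_of_mem_sup_zpowers [Finite G] {p : ℕ} (hp : p.Prime)
    (hmax : ∀ q : ℕ, q.Prime → q ∣ Nat.card G → q ≤ p) {A : Subgroup G} {b : G}
    (hA : ∀ L ≤ zpowers b, Permutes A L) (hb : (orderOf b).Coprime p) {x : G}
    (hx : x ∈ A ⊔ zpowers b) {k : ℕ} (hxk : x ^ p ^ k = 1) : x ∈ A := by
  induction hn : orderOf b using Nat.strong_induction_on generalizing b with
  | _ n ih =>
    by_cases h1 : orderOf b = 1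
    · rw [orderOf_eq_one_iff] at h1
      simpa [h1] using hx
    -- Descend from `b` to `b ^ s`: since `s < p`, the subgroup `A⟨b ^ s⟩` has index less than `p`
    -- in `A⟨b⟩` and still contains `x`.
    set s := (orderOf b).minFac with hs
    have hsp : s.Prime := Nat.minFac_prime h1
    have hsd : s ∣ orderOf b := Nat.minFac_dvd _
    have hlt : s < p := by
      refine lt_of_le_of_ne (hmax s hsp (hsd.trans (_root_.orderOf_dvd_natCard b))) fun he => ?_
      rw [he] at hsd
      exact (Nat.Prime.coprime_iff_not_dvd hp).mp hb.symm hsd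
    have hle : zpowers (b ^ s) ≤ zpowers b := by
      rw [zpowers_le]
      exact pow_mem (mem_zpowers b) s
    have ho : orderOf (b ^ s) = orderOf b / s := orderOf_pow_of_dvd hsp.ne_zero hsd
    refine ih (orderOf (b ^ s)) ?_ (fun L hL => hA L (hL.trans hle)) ?_ ?_ rfl
    · rw [ho, ← hn]
      exact Nat.div_lt_self (orderOf_pos b) hsp.one_lt
    · exact Nat.Coprime.coprime_dvd_left (ho ▸ Nat.div_dvd_of_dvd hsd) hb
    · have hi := index_le_of_sup_zpowers_pow hsp.pos (hA _ le_rfl)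
      have := mem_of_pow_eq_one_of_index_lt hp (hi.trans_lt hlt)
        (x := (⟨x, hx⟩ : (A ⊔ zpowers b : Subgroup G))) (k := k) (Subtype.ext hxk)
      exact mem_subgroupOf.mp this

theorem exists_primary_mul_coprime [Finite G] {p : ℕ} (hp : p.Prime) (b : G) :
    ∃ u ∈ zpowers b, ∃ v ∈ zpowers b, (∃ k, u ^ p ^ k = 1) ∧ (orderOf v).Coprime p ∧
      b = u * v := by
  obtain ⟨k, m, hm, hn⟩ := Nat.exists_eq_pow_mul_and_not_dvd (orderOf_pos b).ne' p hp.ne_one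
  have hc : IsCoprime ((p ^ k : ℕ) : ℤ) (m : ℤ) :=
    Nat.isCoprime_iff_coprime.mpr (Nat.Coprime.pow_left k ((Nat.Prime.coprime_iff_not_dvd hp).mpr hm))
  obtain ⟨x, y, hxy⟩ := hc
  have hb : b ^ ((p ^ k : ℕ) * m : ℤ) = 1 := by
    have := pow_orderOf_eq_one b
    rw [hn] at this
    exact_mod_cast this
  refine ⟨b ^ (y * m), zpow_mem (mem_zpowers b) _, b ^ (x * (p ^ k : ℕ)),
    zpow_mem (mem_zpowers b) _, ⟨k, ?_⟩, ?_, ?_⟩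
  · rw [← zpow_natCast, ← zpow_mul,
      show y * m * ((p ^ k : ℕ) : ℤ) = ((p ^ k : ℕ) * m : ℤ) * y by ring, zpow_mul, hb, one_zpow]
  · refine Nat.Coprime.coprime_dvd_left (orderOf_dvd_of_pow_eq_one (n := m) ?_)
      ((Nat.Prime.coprime_iff_not_dvd hp).mpr hm).symm
    rw [← zpow_natCast, ← zpow_mul,
      show x * ((p ^ k : ℕ) : ℤ) * m = ((p ^ k : ℕ) * m : ℤ) * x by ring, zpow_mul, hb, one_zpow]
  · rw [← zpow_add, add_comm, hxy, zpow_one]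

/-- A proper subgroup containing all elements of order prime to `p` lies in a normal subgroup of
index `p`. -/
theorem exists_normal_index_eq_prime [Finite G] {p : ℕ} (hp : p.Prime) {L : Subgroup G}
    (hL : L ≠ ⊤) (h : ∀ b : G, (orderOf b).Coprime p → b ∈ L) :
    ∃ L₀ : Subgroup G, L ≤ L₀ ∧ L₀.Normal ∧ L₀.index = p := by
  have : Fact p.Prime := ⟨hp⟩
  let V : Subgroup G := closure {b | (orderOf b).Coprime p}
  have hVL : V ≤ L := (closure_le _).mpr h
  have hV : V.Normal := isConjInvariant_top_iff.mp <| isConjInvariant_closure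
    fun r _ x hx => subset_closure <| by
      have : orderOf (r * x * r⁻¹) = orderOf x :=
        orderOf_injective (MulAut.conj r).toMonoidHom (MulAut.conj r).injective x
      change (orderOf (r * x * r⁻¹)).Coprime p
      rw [this]
      exact hx
  have hQ : IsPGroup p (G ⧸ V) := by
    intro q
    induction q using QuotientGroup.induction_on with | _ b
    obtain ⟨u, -, v, -, ⟨k, hk⟩, hv, rfl⟩ := exists_primary_mul_coprime hp b
    refine ⟨k, ?_⟩
    have : ((u * v : G) : G ⧸ V) = (u : G ⧸ V) := by
      rw [QuotientGroup.mk_mul, (QuotientGroup.eq_one_iff v).mpr (subset_closure hv), mul_one]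
    rw [this, ← QuotientGroup.mk_pow, hk, QuotientGroup.mk_one]
  obtain ⟨n, hn⟩ := IsPGroup.iff_card.mp hQ
  obtain ⟨m, hm⟩ := IsPGroup.iff_card.mp (hQ.to_subgroup (L.map (QuotientGroup.mk' V)))
  have hmn : m < n := by
    by_contra hlt
    have h1 : L.map (QuotientGroup.mk' V) = ⊤ := by
      apply eq_top_of_le_card
      rw [hn, hm]
      exact Nat.pow_le_pow_right hp.pos (not_lt.mp hlt)
    apply hL
    have h2 := congrArg (comap (QuotientGroup.mk' V)) h1
    rwa [comap_map_eq, QuotientGroup.ker_mk', sup_eq_left.mpr hVL, comap_top] at h2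
  -- In the `p`-group `G / V` the proper image of `L` lies in a subgroup of order `p ^ (n - 1)`; it
  -- is normal because its index is the least prime divisor of the order.
  obtain ⟨K, hK, hLK⟩ := Sylow.exists_subgroup_card_pow_prime_le p (m := n - 1)
    (hn ▸ pow_dvd_pow p (Nat.sub_le n 1)) _ hm (by omega)
  have hKi : K.index = p := by
    have := K.card_mul_index
    rw [hK, hn, show p ^ n = p ^ (n - 1) * p by rw [← pow_succ]; congr 1; omega] at this
    exact Nat.eq_of_mul_eq_mul_left (pow_pos hp.pos _) this
  have hKn : K.Normal := by
    apply normal_of_index_eq_minFac_card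
    rw [hKi, hn, hp.pow_minFac (by omega)]
  refine ⟨K.comap (QuotientGroup.mk' V), map_le_iff_le_comap.mp hLK, hKn.comap _, ?_⟩
  rw [index_comap_of_surjective _ (QuotientGroup.mk'_surjective V), hKi]

/-- Automorphisms of a cyclic group are power maps. Hence a perfect group acts trivially on it. -/
theorem commute_mulAut_of_isCyclic {C : Type*} [Group C] [IsCyclic C] (f g : MulAut C) :
    f * g = g * f := by
  obtain ⟨m, hm⟩ := MonoidHom.map_cyclic f.toMonoidHom
  obtain ⟨n, hn⟩ := MonoidHom.map_cyclic g.toMonoidHom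
  ext c
  have hm' : ∀ c, f c = c ^ m := hm
  have hn' : ∀ c, g c = c ^ n := hn
  rw [MulAut.mul_apply, MulAut.mul_apply, hm', hn', hm', hn', ← zpow_mul, ← zpow_mul, mul_comm]

end Subgroup

/-! ### Perfect mutually permutable products and the largest prime divisor. -/

namespace Subgroup

variable {G : Type*} [Group G]

/-- The subgroup generated by the elements of `p`-power order of `A`. -/
def primaryClosure (p : ℕ) (A : Subgroup G) : Subgroup G :=
  closure {x | x ∈ A ∧ ∃ k, x ^ p ^ k = 1}

theorem primaryClosure_le (p : ℕ) (A : Subgroup G) : primaryClosure p A ≤ A :=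
  (closure_le _).mpr fun _ hx => hx.1

theorem conj_pow_eq_one {x : G} {n : ℕ} (r : G) (h : x ^ n = 1) : (r * x * r⁻¹) ^ n = 1 := by
  rw [conj_pow, h]; simp

theorem isConjInvariant_primaryClosure (p : ℕ) (A : Subgroup G) :
    IsConjInvariant A (primaryClosure p A) :=
  isConjInvariant_closure fun _ hr _ hx => subset_closure
    ⟨A.mul_mem (A.mul_mem hr hx.1) (A.inv_mem hr), hx.2.imp fun _ => conj_pow_eq_one _⟩

section LargestPrime

variable [Finite G] {p : ℕ}

/-- A conjugate under `⟨b⟩` of a `p`-element of `A` is a `p`-element of `A⟨b⟩`, so it lies in `A` by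
`mem_of_mem_sup_zpowers`. -/
theorem conj_mem_primaryClosure (hp : p.Prime)
    (hmax : ∀ q : ℕ, q.Prime → q ∣ Nat.card G → q ≤ p) {A B : Subgroup G}
    (hAB : MutuallyPermutes A B) {b : G} (hb : b ∈ B) (hbp : (orderOf b).Coprime p) :
    IsConjInvariant (zpowers b) (primaryClosure p A) := by
  have hle : zpowers b ≤ B := by rwa [zpowers_le]
  refine isConjInvariant_closure fun r hr x hx => subset_closure ?_
  obtain ⟨hxA, k, hk⟩ := hx
  have hk' : (r * x * r⁻¹) ^ p ^ k = 1 := conj_pow_eq_one r hk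
  have hr' : r ∈ A ⊔ zpowers b := mem_sup_right hr
  exact ⟨mem_of_mem_sup_zpowers hp hmax (fun L hL => hAB.left L (hL.trans hle)) hbp
    (mul_mem (mul_mem hr' (mem_sup_left hxA)) (inv_mem hr')) hk', k, hk'⟩

/-- In a perfect group with a factorisation `AB` by mutually permuting subgroups, `B` has no proper
normal subgroup of index the largest prime divisor of the group order that contains `A ∩ B`. -/
theorem not_index_eq_prime_of_perfect (hp : p.Prime)
    (hmax : ∀ q : ℕ, q.Prime → q ∣ Nat.card G → q ≤ p) {A B : Subgroup G}
    (hperf : _root_.commutator G = ⊤) (hAB : MutuallyPermutes A B) (htop : A ⊔ B = ⊤)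
    {L : Subgroup G} (hLB : L ≤ B) (hinf : A ⊓ B ≤ L) (hL : IsConjInvariant B L)
    (hcop : ∀ b ∈ B, (orderOf b).Coprime p → b ∈ L) : L.relIndex B ≠ p := by
  intro hidx
  have hmul : ∀ g : G, ∃ b ∈ B, ∃ a ∈ A, g = b * a := fun g =>
    hAB.permutes.exists_mul' (htop ▸ mem_top g)
  have hmul' : ∀ g : G, ∃ a ∈ A, ∃ b ∈ B, g = a * b := fun g =>
    hAB.permutes.exists_mul (htop ▸ mem_top g)
  -- The aim is to show that `AL`, of index `p`, is normal; a perfect group has no normal subgroup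
  -- of index `p`.
  set A₂ := A ⊔ L with hA₂
  have hA₂B : A₂ ⊓ B = L := by
    apply le_antisymm
    · rintro x ⟨hx, hxB⟩
      obtain ⟨a, ha, l, hl, rfl⟩ := (hAB.left L hLB).exists_mul hx
      have : a ∈ B := by simpa using B.mul_mem hxB (B.inv_mem (hLB hl))
      exact mul_mem (hinf ⟨ha, this⟩) hl
    · exact le_inf le_sup_right hLB
  have hA₂i : A₂.index = p := by
    rw [← relIndex_eq_index_of_exists_mul (A := A₂) (B := B), ← inf_relIndex_right, hA₂B, hidx]
    intro g
    obtain ⟨b, hb, a, ha, rfl⟩ := hmul g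
    exact ⟨b, hb, a, mem_sup_left ha, rfl⟩
  set D := A₂.normalCore with hD
  have hDA : D ≤ A₂ := A₂.normalCore_le
  have hLD : L ≤ D := by
    intro l hl g
    obtain ⟨a, ha, b, hb, rfl⟩ := hmul' g
    have : a * b * l * (a * b)⁻¹ = a * (b * l * b⁻¹) * a⁻¹ := by group
    rw [this]
    have ha' : a ∈ A₂ := mem_sup_left ha
    exact mul_mem (mul_mem ha' (mem_sup_right (hL b hb l hl))) (inv_mem ha')
  -- the `p`-elements of `A` lie in the core of `A₂`
  have hpD : ∀ x ∈ A, (∃ k, x ^ p ^ k = 1) → x ∈ D := by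
    rintro x hx ⟨k, hk⟩
    -- `G / D` embeds in the symmetric group on the `p` cosets of `A₂`. Cancelling `p`, the index of
    -- `D` in `A₂` divides `(p - 1)!` and is prime to `p`.
    have h1 : D.relIndex A₂ * p ∣ p.factorial := by
      conv_lhs => rw [← hA₂i, relIndex_mul_index hDA]
      rw [← hA₂i, hD, normalCore_eq_ker, index_ker, index_eq_card A₂, ← Nat.card_perm]
      exact card_subgroup_dvd_card _
    rw [← Nat.mul_factorial_pred hp.ne_zero, mul_comm] at h1
    have h2 := Nat.dvd_of_mul_dvd_mul_left hp.pos h1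
    have h3 : (D.relIndex A₂).Coprime (p ^ k) := by
      refine (Nat.Coprime.pow_left k ((Nat.Prime.coprime_iff_not_dvd hp).mpr fun hd => ?_)).symm
      have := (hp.dvd_factorial).mp (hd.trans h2)
      have := hp.pos
      omega
    have h4 : x ^ D.relIndex A₂ ∈ D := by
      have := pow_index_mem (D.subgroupOf A₂) (⟨x, mem_sup_left hx⟩ : A₂)
      exact mem_subgroupOf.mp this
    have h5 : orderOf (x : G ⧸ D) ∣ 1 := by
      rw [← h3.gcd_eq_one]
      refine Nat.dvd_gcd (orderOf_dvd_of_pow_eq_one ?_) (orderOf_dvd_of_pow_eq_one ?_)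
      · rwa [← QuotientGroup.mk_pow, QuotientGroup.eq_one_iff]
      · rw [← QuotientGroup.mk_pow, hk, QuotientGroup.mk_one]
    rwa [Nat.dvd_one, orderOf_eq_one_iff, QuotientGroup.eq_one_iff] at h5
  have hsup : B ⊔ D = primaryClosure p B ⊔ D := by
    refine le_antisymm (sup_le (fun b hb => ?_) le_sup_right)
      (sup_le_sup_right (primaryClosure_le p B) D)
    obtain ⟨u, hu, v, hv, huk, hvc, rfl⟩ := exists_primary_mul_coprime hp b
    have hle : zpowers (u * v) ≤ B := by rwa [zpowers_le]
    exact mul_mem (mem_sup_left (subset_closure ⟨hle hu, huk⟩))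
      (mem_sup_right (hLD (hcop v (hle hv) hvc)))
  have hDn : D.Normal := A₂.normalCore_normal
  -- Split an element of `A` into its `p`-part, which lies in `D`, and its `p'`-part, which
  -- normalises `primaryClosure p B`.
  have hAinv : IsConjInvariant A (B ⊔ D) := by
    intro a ha m hm
    obtain ⟨u, hu, v, hv, huk, hvc, rfl⟩ := exists_primary_mul_coprime hp a
    have hle : zpowers (u * v) ≤ A := by rwa [zpowers_le]
    have huD : u ∈ B ⊔ D := mem_sup_right (hpD u (hle hu) huk)
    have h1 : v * m * v⁻¹ ∈ B ⊔ D := by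
      rw [hsup] at hm ⊢
      exact ((conj_mem_primaryClosure hp hmax hAB.symm (hle hv) hvc).sup_right
        (hDn.isConjInvariant _)) v (mem_zpowers v) m hm
    have : u * v * m * (u * v)⁻¹ = u * (v * m * v⁻¹) * u⁻¹ := by group
    rw [this]
    exact mul_mem (mul_mem huD h1) (inv_mem huD)
  have hBD : (B ⊔ D).Normal := by
    rw [← isConjInvariant_top_iff, ← htop]
    exact hAinv.sup_left (.of_le le_sup_left)
  -- the normal subgroup `BD / D` is cyclic, hence central
  let q := QuotientGroup.mk' D
  have hqB : (B.map q).Normal := by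
    have : B.map q = (B ⊔ D).map q := by
      rw [map_sup, show D.map q = ⊥ from (map_eq_bot_iff _).mpr (by simp [q]), sup_bot_eq]
    rw [this]
    exact hBD.map q (QuotientGroup.mk'_surjective D)
  have hLn : (L.subgroupOf B).Normal :=
    ⟨fun l hl b => mem_subgroupOf.mpr (hL b b.2 l hl)⟩
  have : Fact p.Prime := ⟨hp⟩
  have hcyc' : IsCyclic (B ⧸ L.subgroupOf B) := isCyclic_of_prime_card (p := p) hidx
  have hker : L.subgroupOf B ≤ (q.subgroupMap B).ker := by
    intro l hl
    rw [MonoidHom.mem_ker]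
    exact Subtype.ext ((QuotientGroup.eq_one_iff _).mpr (hLD hl))
  have hcyc : IsCyclic (B.map q) :=
    isCyclic_of_surjective (QuotientGroup.lift (L.subgroupOf B) (q.subgroupMap B) hker)
      (QuotientGroup.lift_surjective_of_surjective _ _ (q.subgroupMap_surjective B) hker)
  have hcen : ∀ g : G, ∀ b ∈ B, g * b * g⁻¹ * b⁻¹ ∈ D := by
    intro g b hb
    let φ : G →* MulAut (B.map q) := MulAut.conjNormal.comp q
    have hφ : _root_.commutator G ≤ φ.ker :=
      commutator_le_ker φ fun _ _ => commute_mulAut_of_isCyclic _ _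
    have h1 : φ g = 1 := hφ (hperf ▸ mem_top g)
    have h2 := congrArg Subtype.val (DFunLike.congr_fun h1 ⟨q b, mem_map_of_mem q hb⟩)
    have h3 : q g * q b * (q g)⁻¹ = q b := h2
    rw [← QuotientGroup.ker_mk' D, MonoidHom.mem_ker]
    change q _ = 1
    rw [map_mul, map_mul, map_mul, map_inv, map_inv, h3, mul_inv_cancel]
  -- `B` normalises `A₂` because it is central modulo `D ≤ A₂`.
  have hA₂n : A₂.Normal := by
    refine ⟨fun x hx g => ?_⟩
    obtain ⟨a, ha, b, hb, rfl⟩ := hmul' g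
    have ha' : a ∈ A₂ := mem_sup_left ha
    have hbx : b * x * b⁻¹ ∈ A₂ := by
      have h1 := A₂.mul_mem (A₂.inv_mem (hDA (hcen x b hb))) hx
      simpa [mul_assoc] using h1
    have : a * b * x * (a * b)⁻¹ = a * (b * x * b⁻¹) * a⁻¹ := by group
    rw [this]
    exact mul_mem (mul_mem ha' hbx) (inv_mem ha')
  have hcycA : IsCyclic (G ⧸ A₂) := isCyclic_of_prime_card (p := p) hA₂i
  have hle : _root_.commutator G ≤ A₂ := by
    have h := commutator_le_ker (QuotientGroup.mk' A₂) fun _ _ =>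
      isMulCommutative_iff.mp (inferInstance : IsMulCommutative (G ⧸ A₂)) _ _
    rwa [QuotientGroup.ker_mk'] at h
  rw [hperf, top_le_iff] at hle
  rw [hle, index_top] at hA₂i
  exact hp.one_lt.ne hA₂i

/-- Both `A` and the `p'`-elements of `B` normalise `primaryClosure p A`. If those `p'`-elements and
`A ∩ B` generate `B`, this is enough; otherwise they lie in a normal subgroup of `B` of index `p`,
against `not_index_eq_prime_of_perfect`. -/
theorem normal_primaryClosure_of_perfect (hp : p.Prime)
    (hmax : ∀ q : ℕ, q.Prime → q ∣ Nat.card G → q ≤ p) {A B : Subgroup G}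
    (hperf : _root_.commutator G = ⊤) (hAB : MutuallyPermutes A B) (htop : A ⊔ B = ⊤) :
    (primaryClosure p A).Normal := by
  let C : Subgroup G := closure {b | b ∈ B ∧ (orderOf b).Coprime p}
  have hC : IsConjInvariant C (primaryClosure p A) := by
    have : C ≤ normalizer (primaryClosure p A : Set G) := by
      refine (closure_le _).mpr fun b hb => ?_
      exact mem_normalizer_iff.mpr fun m =>
        ((conj_mem_primaryClosure hp hmax hAB hb.1 hb.2).conj_mem_iff (mem_zpowers b)).symm
    exact fun r hr m hm => (mem_normalizer_iff.mp (this hr) m).mp hm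
  have hCB : C ⊔ A ⊓ B ≤ B := sup_le ((closure_le _).mpr fun _ hb => hb.1) inf_le_right
  by_cases h : C ⊔ A ⊓ B = B
  · rw [← isConjInvariant_top_iff, ← htop, ← h]
    have hA := isConjInvariant_primaryClosure p A
    exact hA.sup_left (hC.sup_left (hA.mono inf_le_left))
  exfalso
  obtain ⟨L, hL, hLn, hLi⟩ := exists_normal_index_eq_prime (G := B) hp
    (L := (C ⊔ A ⊓ B).subgroupOf B) (fun ht => h (le_antisymm hCB (subgroupOf_eq_top.mp ht)))
    (fun b hb => mem_subgroupOf.mpr (mem_sup_left (subset_closure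
      ⟨b.2, by rwa [orderOf_coe]⟩)))
  have hL' : C ⊔ A ⊓ B ≤ L.map B.subtype := by
    intro x hx
    exact ⟨⟨x, hCB hx⟩, hL (mem_subgroupOf.mpr hx), rfl⟩
  refine not_index_eq_prime_of_perfect hp hmax hperf hAB htop (L := L.map B.subtype)
    (map_subtype_le L) (le_sup_right.trans hL') ?_ ?_ ?_
  · rintro b hb _ ⟨l, hl, rfl⟩
    exact ⟨⟨b, hb⟩ * l * ⟨b, hb⟩⁻¹, hLn.conj_mem l hl _, rfl⟩
  · exact fun b hb hbp => hL' (mem_sup_left (subset_closure ⟨hb, hbp⟩))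
  · rw [relIndex, subgroupOf, comap_map_eq_self_of_injective B.subtype_injective, hLi]

end LargestPrime

/-- If a nontrivial finite perfect group is the product of two mutually permuting subgroups, one
of them contains a nontrivial normal subgroup. -/
theorem exists_normal_le_of_perfect [Finite G] [Nontrivial G] (hperf : _root_.commutator G = ⊤)
    {A B : Subgroup G} (hAB : MutuallyPermutes A B) (htop : A ⊔ B = ⊤) :
    ∃ M : Subgroup G, M.Normal ∧ M ≠ ⊥ ∧ (M ≤ A ∨ M ≤ B) := by
  have hne : (Nat.card G).primeFactors.Nonempty := by
    rw [Nat.nonempty_primeFactors]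
    exact Finite.one_lt_card
  set p := (Nat.card G).primeFactors.max' hne
  have hpm := Finset.max'_mem _ hne
  have hp : p.Prime := Nat.prime_of_mem_primeFactors hpm
  have : Fact p.Prime := ⟨hp⟩
  have hmax : ∀ q : ℕ, q.Prime → q ∣ Nat.card G → q ≤ p := fun q hq hd =>
    Finset.le_max' _ _ (Nat.mem_primeFactors.mpr ⟨hq, hd, Nat.card_pos.ne'⟩)
  have key : ∀ C : Subgroup G, p ∣ Nat.card C → primaryClosure p C ≠ ⊥ := by
    intro C hC hbot
    obtain ⟨x, hx⟩ := exists_prime_orderOf_dvd_card' (G := C) p hC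
    have : (x : G) ∈ primaryClosure p C := subset_closure ⟨x.2, 1, by
      rw [pow_one, ← hx, ← orderOf_coe, pow_orderOf_eq_one]⟩
    rw [hbot, mem_bot] at this
    rw [← orderOf_coe, this, orderOf_one] at hx
    exact hp.one_lt.ne hx
  have hd : p ∣ Nat.card A * Nat.card B := by
    refine (Nat.dvd_of_mem_primeFactors hpm).trans ?_
    rw [← A.card_mul_index]
    exact mul_dvd_mul_left _ (index_dvd_card_of_exists_mul fun g =>
      hAB.permutes.exists_mul' (htop ▸ mem_top g))
  rcases hp.dvd_mul.mp hd with h | h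
  · exact ⟨_, normal_primaryClosure_of_perfect hp hmax hperf hAB htop, key A h,
      .inl (primaryClosure_le p A)⟩
  · exact ⟨_, normal_primaryClosure_of_perfect hp hmax hperf hAB.symm (sup_comm A B ▸ htop),
      key B h, .inr (primaryClosure_le p B)⟩

end Subgroup

/-! ### Itô's theorem and nonabelian minimal normal subgroups. -/

namespace Subgroup

variable {G : Type*} [Group G]

/-- **Itô's theorem**: a product of two abelian groups has abelian derived subgroup. -/
theorem commutator_commutative_of_mul {A B : Subgroup G} (hA : ∀ x ∈ A, ∀ y ∈ A, x * y = y * x)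
    (hB : ∀ x ∈ B, ∀ y ∈ B, x * y = y * x) (hAB : Permutes A B) (htop : A ⊔ B = ⊤)
    {x y : G} (hx : x ∈ _root_.commutator G) (hy : y ∈ _root_.commutator G) : x * y = y * x := by
  let s : Set G := {c | ∃ a ∈ A, ∃ b ∈ B, c = a⁻¹ * b⁻¹ * a * b}
  have hmul : ∀ g : G, ∃ a ∈ A, ∃ b ∈ B, g = a * b := fun g =>
    hAB.exists_mul (htop ▸ mem_top g)
  have hmul' : ∀ g : G, ∃ b ∈ B, ∃ a ∈ A, g = b * a := fun g =>
    hAB.exists_mul' (htop ▸ mem_top g)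
  -- Write `[a, b] = a⁻¹b⁻¹ab`. Conjugation by an element of `A` changes only the entry `b`, as `A`
  -- is abelian; `conjB` is the mirror image.
  have conjA : ∀ a ∈ A, ∀ b ∈ B, ∀ α ∈ A, ∀ a₁ ∈ A, ∀ b₁ ∈ B, α⁻¹ * b * α = a₁ * b₁ →
      α⁻¹ * (a⁻¹ * b⁻¹ * a * b) * α = a⁻¹ * b₁⁻¹ * a * b₁ := by
    intro a ha b hb α hα a₁ ha₁ b₁ hb₁ e
    have h1 : α⁻¹ * a⁻¹ = a⁻¹ * α⁻¹ := hA _ (inv_mem hα) _ (inv_mem ha)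
    have h2 : α⁻¹ * a = a * α⁻¹ := hA _ (inv_mem hα) _ ha
    have h3 : a₁⁻¹ * a = a * a₁⁻¹ := hA _ (inv_mem ha₁) _ ha
    have h2' : a * α = α * a := hA _ ha _ hα
    calc α⁻¹ * (a⁻¹ * b⁻¹ * a * b) * α
        = (α⁻¹ * a⁻¹) * b⁻¹ * α * (α⁻¹ * a) * b * α := by group
      _ = a⁻¹ * (α⁻¹ * b * α)⁻¹ * a * (α⁻¹ * b * α) := by rw [h1, h2]; group
      _ = a⁻¹ * b₁⁻¹ * (a₁⁻¹ * a) * a₁ * b₁ := by rw [e]; group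
      _ = _ := by rw [h3]; group
  have conjB : ∀ a ∈ A, ∀ b ∈ B, ∀ β ∈ B, ∀ b₂ ∈ B, ∀ a₂ ∈ A, β⁻¹ * a * β = b₂ * a₂ →
      β⁻¹ * (a⁻¹ * b⁻¹ * a * b) * β = a₂⁻¹ * b⁻¹ * a₂ * b := by
    intro a ha b hb β hβ b₂ hb₂ a₂ ha₂ e
    have h1 : β * b⁻¹ = b⁻¹ * β := hB _ hβ _ (inv_mem hb)
    have h2 : b * β = β * b := hB _ hb _ hβ
    have h3 : b⁻¹ * b₂ = b₂ * b⁻¹ := hB _ (inv_mem hb) _ hb₂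
    calc β⁻¹ * (a⁻¹ * b⁻¹ * a * b) * β
        = β⁻¹ * a⁻¹ * (b⁻¹ * β) * β⁻¹ * a * (b * β) := by group
      _ = (β⁻¹ * a * β)⁻¹ * b⁻¹ * (β⁻¹ * a * β) * b := by rw [h2, ← h1]; group
      _ = a₂⁻¹ * b₂⁻¹ * (b⁻¹ * b₂) * a₂ * b := by rw [e]; group
      _ = _ := by rw [h3]; group
  have hinv : IsConjInvariant ⊤ (closure s) := by
    rw [← htop]
    refine IsConjInvariant.sup_left ?_ ?_
    · refine isConjInvariant_closure ?_
      rintro r hr _ ⟨a, ha, b, hb, rfl⟩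
      obtain ⟨a₁, ha₁, b₁, hb₁, e⟩ := hmul (r⁻¹⁻¹ * b * r⁻¹)
      have := conjA a ha b hb r⁻¹ (inv_mem hr) a₁ ha₁ b₁ hb₁ e
      rw [inv_inv] at this
      exact this ▸ subset_closure ⟨a, ha, b₁, hb₁, rfl⟩
    · refine isConjInvariant_closure ?_
      rintro r hr _ ⟨a, ha, b, hb, rfl⟩
      obtain ⟨b₂, hb₂, a₂, ha₂, e⟩ := hmul' (r⁻¹⁻¹ * a * r⁻¹)
      have := conjB a ha b hb r⁻¹ (inv_mem hr) b₂ hb₂ a₂ ha₂ e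
      rw [inv_inv] at this
      exact this ▸ subset_closure ⟨a₂, ha₂, b, hb, rfl⟩
  have hn : (closure s).Normal := isConjInvariant_top_iff.mp hinv
  have hs : ∀ x ∈ s, ∀ y ∈ s, x * y = y * x := by
    rintro _ ⟨a, ha, b, hb, rfl⟩ _ ⟨α, hα, β, hβ, rfl⟩
    -- Conjugating `[a, b]` by `α⁻¹` and `β⁻¹`, in either order, gives the same element `[a₂, b₁]`;
    -- hence `[α, β]` commutes with `[a, b]`.
    obtain ⟨a₁, ha₁, b₁, hb₁, e₁⟩ := hmul (α⁻¹⁻¹ * b * α⁻¹)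
    obtain ⟨b₂, hb₂, a₂, ha₂, e₂⟩ := hmul' (β⁻¹⁻¹ * a * β⁻¹)
    have h1 := conjA a ha b hb _ (inv_mem hα) a₁ ha₁ b₁ hb₁ e₁
    have h2 := conjB a ha b₁ hb₁ _ (inv_mem hβ) b₂ hb₂ a₂ ha₂ e₂
    have h3 := conjB a ha b hb _ (inv_mem hβ) b₂ hb₂ a₂ ha₂ e₂
    have h4 := conjA a₂ ha₂ b hb _ (inv_mem hα) a₁ ha₁ b₁ hb₁ e₁
    rw [← h1] at h2
    rw [← h3, ← h2] at h4
    generalize a⁻¹ * b⁻¹ * a * b = c at h4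
    simp only [inv_inv] at h4
    have h5 : c = (α⁻¹ * β⁻¹ * α * β) * c * (α⁻¹ * β⁻¹ * α * β)⁻¹ := by
      calc c = α⁻¹ * β⁻¹ * (β * (α * c * α⁻¹) * β⁻¹) * β * α := by group
        _ = _ := by rw [← h4]; group
    calc c * (α⁻¹ * β⁻¹ * α * β)
        = (α⁻¹ * β⁻¹ * α * β) * c * (α⁻¹ * β⁻¹ * α * β)⁻¹ * (α⁻¹ * β⁻¹ * α * β) := by rw [← h5]
      _ = _ := by group
  have hcs : ∀ a ∈ A, ∀ b ∈ B, ((a : G ⧸ closure s)) * b = b * a := by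
    intro a ha b hb
    rw [← QuotientGroup.mk_mul, ← QuotientGroup.mk_mul, QuotientGroup.eq]
    have : (a * b)⁻¹ * (b * a) = (a⁻¹ * b⁻¹ * a * b)⁻¹ := by group
    rw [this]
    exact inv_mem (subset_closure ⟨a, ha, b, hb, rfl⟩)
  have hle : _root_.commutator G ≤ closure s := by
    have := commutator_le_ker (QuotientGroup.mk' (closure s)) ?_
    · rwa [QuotientGroup.ker_mk'] at this
    intro x y
    obtain ⟨a, ha, b, hb, rfl⟩ := hmul x
    obtain ⟨a', ha', b', hb', rfl⟩ := hmul y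
    simp only [map_mul, QuotientGroup.mk'_apply]
    have e1 : (a : G ⧸ closure s) * a' = a' * a := by
      rw [← QuotientGroup.mk_mul, hA a ha a' ha', QuotientGroup.mk_mul]
    have e2 : (b : G ⧸ closure s) * b' = b' * b := by
      rw [← QuotientGroup.mk_mul, hB b hb b' hb', QuotientGroup.mk_mul]
    exact ((Commute.mul_left (Commute.mul_right e1 (hcs a ha b' hb'))
      (Commute.mul_right (hcs a' ha' b hb).symm e2)) : Commute _ _)
  have hcc : ∀ x ∈ closure s, ∀ y ∈ closure s, x * y = y * x := by
    intro x hx y hy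
    have h1 : closure s ≤ centralizer s := (closure_le _).mpr fun x hx =>
      mem_centralizer_iff.mpr fun y hy => hs y hy x hx
    have h2 : closure s ≤ centralizer (closure s : Set G) := (closure_le _).mpr fun x hx =>
      mem_centralizer_iff.mpr fun y hy => (mem_centralizer_iff.mp (h1 hy) x hx).symm
    exact (mem_centralizer_iff.mp (h2 hy) x hx)
  exact hcc x (hle hx) y (hle hy)

/-- The intersection `(H ∩ N)(K ∩ N)` of a normal subgroup with a mutually permutable product. -/
theorem normal_inf_sup_inf {H K N : Subgroup G} (hN : N.Normal) (h : MutuallyPermutes H K)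
    (htop : H ⊔ K = ⊤) : (H ⊓ N ⊔ K ⊓ N).Normal := by
  have key : ∀ {H K : Subgroup G}, MutuallyPermutes H K →
      IsConjInvariant H (H ⊓ N ⊔ K ⊓ N) := by
    intro H K h
    have : H ⊓ N ⊔ K ⊓ N = (H ⊔ K ⊓ N) ⊓ N := by
      apply le_antisymm
      · exact le_inf (sup_le_sup_right inf_le_left _) (sup_le inf_le_right inf_le_right)
      · rintro x ⟨hx, hxN⟩
        obtain ⟨a, ha, b, hb, rfl⟩ := (h.left _ inf_le_left).exists_mul hx
        have : a ∈ N := by simpa using N.mul_mem hxN (N.inv_mem hb.2)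
        exact mul_mem (mem_sup_left ⟨ha, this⟩) (mem_sup_right hb)
    rw [this]
    exact (IsConjInvariant.of_le le_sup_left).inf (hN.isConjInvariant H)
  rw [← isConjInvariant_top_iff, ← htop]
  refine (key h).sup_left ?_
  rw [sup_comm]
  exact key h.symm

theorem map_conj_eq {W : Subgroup G} {k x : G} :
    x ∈ W.map (MulAut.conj k).toMonoidHom ↔ k⁻¹ * x * k ∈ W := by
  constructor
  · rintro ⟨w, hw, rfl⟩
    simpa [mul_assoc] using hw
  · intro h
    exact ⟨_, h, by simp [mul_assoc]⟩

/-- A group `G` with a nonabelian minimal normal subgroup `N = G'` inducing inner automorphisms on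
the minimal normal subgroups of `N`. -/
structure InnerSocle (N : Subgroup G) : Prop where
  minimal : IsMinInvariant ⊤ N
  nonabelian : ¬ ∀ x ∈ N, ∀ y ∈ N, x * y = y * x
  commutator_eq : _root_.commutator G = N
  inner : ∀ W ≤ N, IsMinInvariant N W → ∀ g ∈ N, ∃ w ∈ W, ∀ x ∈ W, g * x * g⁻¹ = w * x * w⁻¹

/-- Nonabelian minimal `H`-invariant subgroups of `H` are simple. -/
def HasSimpleMinInvariant (H : Subgroup G) : Prop :=
  ∀ W ≤ H, IsMinInvariant H W → (¬ ∀ x ∈ W, ∀ y ∈ W, x * y = y * x) →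
    ∀ L ≤ W, IsConjInvariant W L → L ≠ ⊥ → L = W

namespace InnerSocle

variable {N : Subgroup G} (h : InnerSocle N)
include h

theorem normal : N.Normal := isConjInvariant_top_iff.mp h.minimal.inv

theorem eq_of_normal {L : Subgroup G} (hL : L.Normal) (hLN : L ≤ N) (hb : L ≠ ⊥) : L = N :=
  h.minimal.eq_of_le L hLN (hL.isConjInvariant _) hb

theorem center_eq_bot : N ⊓ centralizer (N : Set G) = ⊥ := by
  have := h.normal
  by_contra hb
  have h1 := h.eq_of_normal (L := N ⊓ centralizer (N : Set G)) inferInstance inf_le_left hb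
  refine h.nonabelian fun x hx y hy => ?_
  rw [← h1] at hy
  exact mem_centralizer_iff.mp hy.2 x hx

/-- `N` acts on `W` by inner automorphisms of `W`, so an abelian `W` would be central in `N`. -/
theorem not_abelian {W : Subgroup G} (hWN : W ≤ N) (hW : IsMinInvariant N W) :
    ¬ ∀ x ∈ W, ∀ y ∈ W, x * y = y * x := by
  intro hab
  apply hW.ne_bot
  rw [eq_bot_iff, ← h.center_eq_bot]
  refine le_inf hWN fun x hx => mem_centralizer_iff.mpr fun g hg => ?_
  obtain ⟨w, hw, e⟩ := h.inner W hWN hW g hg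
  have := e x hx
  rw [hab w hw x hx, mul_inv_cancel_right, mul_inv_eq_iff_eq_mul] at this
  exact this

/-- Since `N` acts on `W` by inner automorphisms, normal subgroups of `W` are `N`-invariant: `W` is
simple. -/
theorem eq_of_isConjInvariant {W : Subgroup G} (hWN : W ≤ N) (hW : IsMinInvariant N W)
    {L : Subgroup G} (hL : L ≤ W) (hLW : IsConjInvariant W L) (hb : L ≠ ⊥) : L = W := by
  refine hW.eq_of_le L hL (fun g hg x hx => ?_) hb
  obtain ⟨w, hw, e⟩ := h.inner W hWN hW g hg
  rw [e x (hL hx)]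
  exact hLW w hw x hx

theorem commutator_eq_top : _root_.commutator N = ⊤ := by
  have := h.normal
  have h1 : ⁅N, N⁆ = N := by
    refine h.eq_of_normal inferInstance (commutator_le_self N) fun hb => h.nonabelian ?_
    intro x hx y hy
    have : ⁅x, y⁆ ∈ (⊥ : Subgroup G) := hb ▸ commutator_mem_commutator hx hy
    rwa [mem_bot, commutatorElement_eq_one_iff_mul_comm] at this
  apply map_injective N.subtype_injective
  rw [map_subtype_commutator, h1, ← MonoidHom.range_eq_map, range_subtype]

/-- The normal closure `M` of `W` in `H` turns out to be a nonabelian minimal `H`-invariant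
subgroup. By hypothesis it is then simple, so its normal subgroup `W` is all of it. -/
theorem conjInvariant_of_le [Finite G] {H : Subgroup G} (hH : HasSimpleMinInvariant H)
    {W : Subgroup G} (hWN : W ≤ N) (hW : IsMinInvariant N W) (hWH : W ≤ H) :
    IsConjInvariant H W := by
  have hN := h.normal
  let M : Subgroup G := closure {x | ∃ g ∈ H, ∃ w ∈ W, x = g * w * g⁻¹}
  have hMH : IsConjInvariant H M := isConjInvariant_closure <| by
    rintro r hr _ ⟨g, hg, w, hw, rfl⟩
    exact subset_closure ⟨r * g, mul_mem hr hg, w, hw, by group⟩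
  have hMle : M ≤ H ⊓ N := (closure_le _).mpr <| by
    rintro _ ⟨g, hg, w, hw, rfl⟩
    exact ⟨H.mul_mem (H.mul_mem hg (hWH hw)) (H.inv_mem hg), hN.conj_mem w (hWN hw) g⟩
  have hMN : IsConjInvariant N M := isConjInvariant_closure <| by
    rintro r hr _ ⟨g, hg, w, hw, rfl⟩
    refine subset_closure ⟨g, hg, (g⁻¹ * r * g) * w * (g⁻¹ * r * g)⁻¹, ?_, by group⟩
    have : g⁻¹ * r * g ∈ N := by simpa using hN.conj_mem r hr g⁻¹
    exact hW.inv _ this w hw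
  have hWM : W ≤ M := fun w hw => subset_closure ⟨1, one_mem _, w, hw, by group⟩
  have hMb : M ≠ ⊥ := fun hb => hW.ne_bot (eq_bot_iff.mpr (hb ▸ hWM))
  obtain ⟨R, hRM, hR⟩ := exists_isMinInvariant hMH hMb
  have hWR : W ≤ R := by
    by_cases hRW : R ⊓ W = ⊥
    -- Here `R` centralises every `H`-conjugate of `W`, so `R` lies in the centre of `M`. That
    -- centre is `N`-invariant and would contain an abelian minimal `N`-invariant subgroup.
    · exfalso
      have hc : ∀ r ∈ R, ∀ w ∈ W, r * w = w * r := fun r hr w hw =>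
        commute_of_inf_eq_bot (hW.inv.mono (hRM.trans (hMle.trans inf_le_right)))
          (hR.inv.mono hWH) hRW hr hw
      have hcM : M ≤ centralizer (R : Set G) := (closure_le _).mpr <| by
        rintro _ ⟨g, hg, w, hw, rfl⟩
        refine mem_centralizer_iff.mpr fun r hr => ?_
        have h1 : g⁻¹ * r * g ∈ R := by simpa using hR.inv g⁻¹ (inv_mem hg) r hr
        have h2 := hc _ h1 w hw
        calc r * (g * w * g⁻¹) = g * ((g⁻¹ * r * g) * w) * g⁻¹ := by group
          _ = _ := by rw [h2]; group
      let Z : Subgroup G := M ⊓ centralizer (M : Set G)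
      have hRZ : R ≤ Z := le_inf hRM fun r hr =>
        mem_centralizer_iff.mpr fun m hm => (mem_centralizer_iff.mp (hcM hm) r hr).symm
      have hZN : IsConjInvariant N Z := by
        refine hMN.inf fun g hg z hz => mem_centralizer_iff.mpr fun m hm => ?_
        have h1 : g⁻¹ * m * g ∈ M := by simpa using hMN g⁻¹ (inv_mem hg) m hm
        have h2 := mem_centralizer_iff.mp hz _ h1
        calc m * (g * z * g⁻¹) = g * ((g⁻¹ * m * g) * z) * g⁻¹ := by group
          _ = _ := by rw [h2]; group
      have hZb : Z ≠ ⊥ := fun hb => hR.ne_bot (eq_bot_iff.mpr (hb ▸ hRZ))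
      obtain ⟨V, hVZ, hV⟩ := exists_isMinInvariant hZN hZb
      exact h.not_abelian (hVZ.trans (inf_le_left.trans (hMle.trans inf_le_right))) hV
        fun x hx y hy => mem_centralizer_iff.mp (hVZ hy).2 x (hVZ hx).1
    · have := h.eq_of_isConjInvariant hWN hW (L := R ⊓ W) inf_le_right
        ((hR.inv.mono hWH).inf (.of_le le_rfl)) hRW
      exact this ▸ inf_le_left
  have hMR : M ≤ R := (closure_le _).mpr <| by
    rintro _ ⟨g, hg, w, hw, rfl⟩
    exact hR.inv g hg w (hWR hw)
  have hMeq : R = M := le_antisymm hRM hMR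
  rw [hMeq] at hR
  have := hH M (hMle.trans inf_le_left) hR
    (fun hab => h.not_abelian hWN hW fun x hx y hy => hab x (hWM hx) y (hWM hy)) W hWM
    (hW.inv.mono (hMle.trans inf_le_right)) hW.ne_bot
  rw [this]
  exact hMH

/-- `H` normalises `W`, so it remains to exclude that `K` does not. In that case `N = (K ∩ N)W`, and
a `K`-conjugate of `W` centralises `W`; thus `K ∩ N` induces all inner automorphisms of `W`, and `K
∩ W` is `1` or `W`. Either value is contradictory. -/
theorem eq_of_le_left [Finite G] {H K : Subgroup G} (hHK : MutuallyPermutes H K)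
    (htop : H ⊔ K = ⊤) (hH : HasSimpleMinInvariant H) (hK : HasSimpleMinInvariant K)
    {W : Subgroup G} (hWN : W ≤ N) (hW : IsMinInvariant N W) (hWH : W ≤ H) : W = N := by
  have hN := h.normal
  have hHW := h.conjInvariant_of_le hH hWN hW hWH
  by_contra hne
  have hKW : ¬ IsConjInvariant K W := fun hKW => hne <|
    h.eq_of_normal (isConjInvariant_top_iff.mp (htop ▸ hHW.sup_left hKW)) hWN hW.ne_bot
  have hNle : N ≤ K ⊔ W := by
    let M : Subgroup G := closure {x | ∃ g ∈ K, ∃ w ∈ W, x = g * w * g⁻¹}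
    have hM : M.Normal := by
      rw [← isConjInvariant_top_iff, ← htop]
      refine IsConjInvariant.sup_left (isConjInvariant_closure ?_) (isConjInvariant_closure ?_)
      · rintro r hr _ ⟨g, hg, w, hw, rfl⟩
        obtain ⟨g', hg', r', hr', e⟩ := hHK.permutes r hr g hg
        refine subset_closure ⟨g', hg', r' * w * r'⁻¹, hHW r' hr' w hw, ?_⟩
        calc r * (g * w * g⁻¹) * r⁻¹ = (r * g) * w * (r * g)⁻¹ := by group
          _ = _ := by rw [e]; group
      · rintro r hr _ ⟨g, hg, w, hw, rfl⟩
        exact subset_closure ⟨r * g, mul_mem hr hg, w, hw, by group⟩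
    have hWM : W ≤ M := fun w hw => subset_closure ⟨1, one_mem _, w, hw, by group⟩
    have hMN : M ≤ N := (closure_le _).mpr <| by
      rintro _ ⟨g, hg, w, hw, rfl⟩
      exact hN.conj_mem w (hWN hw) g
    have := h.eq_of_normal hM hMN fun hb => hW.ne_bot (eq_bot_iff.mpr (hb ▸ hWM))
    rw [← this]
    refine (closure_le _).mpr ?_
    rintro _ ⟨g, hg, w, hw, rfl⟩
    have hg' : g ∈ K ⊔ W := mem_sup_left hg
    exact mul_mem (mul_mem hg' (mem_sup_right hw)) (inv_mem hg')
  have hmul : ∀ n ∈ N, ∃ b ∈ K ⊓ N, ∃ w ∈ W, n = b * w := by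
    intro n hn
    obtain ⟨b, hb, w, hw, rfl⟩ := (hHK.right W hWH).exists_mul (hNle hn)
    refine ⟨b, ⟨hb, ?_⟩, w, hw, rfl⟩
    simpa using N.mul_mem hn (N.inv_mem (hWN hw))
  obtain ⟨k, hk, w₀, hw₀, hkw⟩ : ∃ k ∈ K, ∃ w ∈ W, k * w * k⁻¹ ∉ W := by
    simpa [IsConjInvariant] using hKW
  -- a conjugate of `W` centralises `W`
  have hcomm : ∀ v ∈ W, ∀ w ∈ W, (k * v * k⁻¹) * w = w * (k * v * k⁻¹) := by
    let W' := W.map (MulAut.conj k).toMonoidHom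
    have hW'N : IsConjInvariant N W' := by
      intro g hg x hx
      rw [map_conj_eq] at hx ⊢
      have h1 : k⁻¹ * g * k ∈ N := by simpa using hN.conj_mem g hg k⁻¹
      have := hW.inv _ h1 _ hx
      have e : k⁻¹ * (g * x * g⁻¹) * k = k⁻¹ * g * k * (k⁻¹ * x * k) * (k⁻¹ * g * k)⁻¹ := by group
      rwa [e]
    have hW'le : W' ≤ N := by
      rintro _ ⟨w, hw, rfl⟩
      exact hN.conj_mem w (hWN hw) k
    have hbot : W' ⊓ W = ⊥ := by
      by_contra hb
      have h1 := hW.eq_of_le (W' ⊓ W) inf_le_right (hW'N.inf hW.inv) hb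
      have h2 : W = W' := by
        refine eq_of_le_of_card_ge (h1 ▸ inf_le_left) ?_
        exact (Nat.card_congr (W.equivMapOfInjective (MulAut.conj k).toMonoidHom
          (MulAut.conj k).injective).toEquiv).ge
      apply hkw
      rw [h2]
      exact ⟨w₀, hw₀, rfl⟩
    intro v hv w hw
    exact commute_of_inf_eq_bot (hW.inv.mono hW'le) (hW'N.mono hWN) hbot ⟨v, hv, rfl⟩ hw
  -- Factor `k⁻¹wk = bv` in `(K ∩ N)W` and conjugate back: the factor `kvk⁻¹` acts trivially on `W`.
  have hact : ∀ w ∈ W, ∃ b ∈ K ⊓ N, ∀ x ∈ W, w * x * w⁻¹ = b * x * b⁻¹ := by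
    intro w hw
    have h1 : k⁻¹ * w * k ∈ N := by simpa using hN.conj_mem w (hWN hw) k⁻¹
    obtain ⟨b, hb, v, hv, e⟩ := hmul _ h1
    refine ⟨k * b * k⁻¹, ⟨K.mul_mem (K.mul_mem hk hb.1) (K.inv_mem hk), hN.conj_mem b hb.2 k⟩, ?_⟩
    intro x hx
    have e' : w = (k * b * k⁻¹) * (k * v * k⁻¹) := by
      calc w = k * (k⁻¹ * w * k) * k⁻¹ := by group
        _ = _ := by rw [e]; group
    have e2 : (k * v * k⁻¹) * x * (k * v * k⁻¹)⁻¹ = x := by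
      rw [hcomm v hv x hx, mul_inv_cancel_right]
    calc w * x * w⁻¹ = (k * b * k⁻¹) * ((k * v * k⁻¹) * x * (k * v * k⁻¹)⁻¹) * (k * b * k⁻¹)⁻¹ := by
          rw [e']; group
      _ = _ := by rw [e2]
  have hmin : ∀ L ≤ W, IsConjInvariant (K ⊓ N) L → L ≠ ⊥ → L = W := by
    intro L hL hLi hb
    refine h.eq_of_isConjInvariant hWN hW hL (fun w hw x hx => ?_) hb
    obtain ⟨b, hb, e⟩ := hact w hw
    rw [e x (hL hx)]
    exact hLi b hb x hx
  by_cases hKWb : K ⊓ W = ⊥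
  -- As `K` permutes with `L` and `K ∩ W = 1`, one has `L = KL ∩ W`, which `K ∩ N` normalises. So
  -- `W` has no proper nontrivial subgroup and is cyclic.
  · have hall : ∀ L ≤ W, L ≠ ⊥ → L = W := by
      intro L hL hb
      refine hmin L hL ?_ hb
      have : L = (K ⊔ L) ⊓ W := by
        refine le_antisymm (le_inf le_sup_right hL) ?_
        rintro x ⟨hx, hxW⟩
        obtain ⟨b, hb, l, hl, rfl⟩ := (hHK.right L (hL.trans hWH)).exists_mul hx
        have hbW : b ∈ K ⊓ W := ⟨hb, by simpa using W.mul_mem hxW (W.inv_mem (hL hl))⟩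
        rw [hKWb, mem_bot] at hbW
        simpa [hbW] using hl
      rw [this]
      exact (IsConjInvariant.of_le (inf_le_left.trans le_sup_left)).inf
        (hW.inv.mono inf_le_right)
    obtain ⟨w, hw, hw1⟩ := W.bot_or_exists_ne_one.resolve_left hW.ne_bot
    have hz : zpowers w = W := hall _ (by rwa [zpowers_le]) (by rwa [Ne, zpowers_eq_bot])
    refine h.not_abelian hWN hW ?_
    rw [← hz]
    rintro _ ⟨i, rfl⟩ _ ⟨j, rfl⟩
    exact zpow_mul_comm w i j
  · have h1 := hmin (K ⊓ W) inf_le_right ((IsConjInvariant.of_le inf_le_left).inf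
      (hW.inv.mono inf_le_right)) hKWb
    have h2 : W ≤ K := h1 ▸ inf_le_left
    exact hKW (h.conjInvariant_of_le hK hWN hW h2)

theorem simple [Finite G] {H K : Subgroup G} (hHK : MutuallyPermutes H K)
    (htop : H ⊔ K = ⊤) (hH : HasSimpleMinInvariant H) (hK : HasSimpleMinInvariant K) :
    IsMinInvariant N N := by
  have hN := h.normal
  by_cases hJ : H ⊓ N ⊔ K ⊓ N = ⊥
  -- `H' ≤ H ∩ G' = H ∩ N = 1`, and likewise for `K`; Itô's theorem then makes `G' = N` abelian.
  · exfalso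
    have key : ∀ A : Subgroup G, A ⊓ N = ⊥ → ∀ x ∈ A, ∀ y ∈ A, x * y = y * x := by
      intro A hA x hx y hy
      have h1 : ⁅x, y⁆ ∈ A ⊓ N := by
        refine ⟨commutator_le_self A (commutator_mem_commutator hx hy), ?_⟩
        rw [← h.commutator_eq]
        exact commutator_mem_commutator (mem_top x) (mem_top y)
      rwa [hA, mem_bot, commutatorElement_eq_one_iff_mul_comm] at h1
    rw [sup_eq_bot_iff] at hJ
    refine h.nonabelian fun x hx y hy => ?_
    rw [← h.commutator_eq] at hx hy
    exact commutator_commutative_of_mul (key H hJ.1) (key K hJ.2) hHK.permutes htop hx hy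
  have hJN := h.eq_of_normal (normal_inf_sup_inf hN hHK htop) (sup_le inf_le_right inf_le_right) hJ
  have : Nontrivial N := (nontrivial_iff_ne_bot N).mpr h.minimal.ne_bot
  obtain ⟨M, hM, hMb, hMle⟩ := exists_normal_le_of_perfect h.commutator_eq_top
    ((hHK.inf N).subgroupOf inf_le_right inf_le_right)
    (by rw [← subgroupOf_sup inf_le_right inf_le_right, hJN, subgroupOf_self])
  have hMinv : IsConjInvariant N (M.map N.subtype) := by
    rintro g hg _ ⟨m, hm, rfl⟩
    exact ⟨⟨g, hg⟩ * m * ⟨g, hg⟩⁻¹, hM.conj_mem m hm _, rfl⟩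
  obtain ⟨W, hWM, hW⟩ := exists_isMinInvariant hMinv
    (fun hb => hMb ((map_eq_bot_iff_of_injective M N.subtype_injective).mp hb))
  have hWN : W ≤ N := hWM.trans (map_subtype_le M)
  have hle : ∀ {A : Subgroup G}, M ≤ (A ⊓ N).subgroupOf N → W ≤ A := by
    intro A hA x hx
    obtain ⟨m, hm, rfl⟩ := hWM hx
    exact (mem_subgroupOf.mp (hA hm)).1
  have : W = N := hMle.elim
    (fun hA => h.eq_of_le_left hHK htop hH hK hWN hW (hle hA))
    (fun hA => h.eq_of_le_left hHK.symm (sup_comm H K ▸ htop) hK hH hWN hW (hle hA))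
  rwa [this] at hW

end InnerSocle

end Subgroup

/-! ### Closure properties of formations. -/

namespace FiniteGroupClass

variable {F : FiniteGroupClass.{u}}

theorem IsFormation.mem_of_surjective (hF : F.IsFormation) {A B : Type u} [Group A] [Group B]
    (f : A →* B) (hf : Function.Surjective f) (hA : F.Mem A) : F.Mem B :=
  F.mem_of_mulEquiv _ _ (QuotientGroup.quotientKerEquivOfSurjective f hf)
    (hF.quotient_mem A f.ker hA)

/-- A formation is closed under subdirect products. -/
theorem IsFormation.mem_of_ker_inf_ker (hF : F.IsFormation) {A B C : Type u} [Group A] [Finite A]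
    [Group B] [Group C] (f : A →* B) (hf : Function.Surjective f) (g : A →* C)
    (hg : Function.Surjective g) (h : f.ker ⊓ g.ker = ⊥) (hB : F.Mem B) (hC : F.Mem C) :
    F.Mem A := by
  obtain ⟨R, hRn, hR, hmin⟩ := hF.exists_residual A
  have h1 := hmin f.ker
    (F.mem_of_mulEquiv _ _ (QuotientGroup.quotientKerEquivOfSurjective f hf).symm hB)
  have h2 := hmin g.ker
    (F.mem_of_mulEquiv _ _ (QuotientGroup.quotientKerEquivOfSurjective g hg).symm hC)
  obtain rfl : R = ⊥ := eq_bot_iff.mpr (h ▸ le_inf h1 h2)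
  exact F.mem_of_mulEquiv _ _ QuotientGroup.quotientBot hR

theorem IsFormation.prod_mem (hF : F.IsFormation) {A B : Type u} [Group A] [Group B]
    (hA : F.Mem A) (hB : F.Mem B) : F.Mem (A × B) := by
  have := F.finite_of_mem A hA
  have := F.finite_of_mem B hB
  refine hF.mem_of_ker_inf_ker (MonoidHom.fst A B) Prod.fst_surjective (MonoidHom.snd A B)
    Prod.snd_surjective ?_ hA hB
  rw [eq_bot_iff]
  rintro ⟨a, b⟩ ⟨ha, hb⟩
  exact Prod.ext ha hb

theorem IsSaturatedFormation.mem_of_surjective_of_ker_le (hF : F.IsSaturatedFormation)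
    {A B : Type u} [Group A] [Finite A] [Group B] (f : A →* B) (hf : Function.Surjective f)
    (hker : f.ker ≤ frattini A) (hB : F.Mem B) : F.Mem A := by
  have : (frattini A).Normal := inferInstance
  have h := F.mem_of_mulEquiv _ _ (QuotientGroup.quotientKerEquivOfSurjective f hf).symm hB
  refine hF.saturated A (hF.mem_of_surjective (QuotientGroup.map f.ker (frattini A)
    (MonoidHom.id A) hker) ?_ h)
  intro x
  induction x using QuotientGroup.induction_on with | _ x
  exact ⟨x, rfl⟩

/-- If a group `X` of a formation acts on a commutative group `N` isomorphic to a normal subgroup of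
`X` with the conjugation action, then the corresponding semidirect product is in the formation. -/
theorem IsFormation.semidirect_mem (hF : F.IsFormation) {X N : Type u} [Group X] [CommGroup N]
    (j : N →* X) (hj : Function.Injective j) (ρ : X →* MulAut N)
    (hρ : ∀ x n, j (ρ x n) = x * j n * x⁻¹) (hX : F.Mem X) : F.Mem (N ⋊[ρ] X) := by
  have := F.finite_of_mem X hX
  have : Finite N := Finite.of_injective j hj
  have : Finite (N ⋊[ρ] X) := Finite.of_equiv _ SemidirectProduct.equivProd.symm
  -- Besides the projection there is a second surjection `(n, x) ↦ j n * x` onto `X`. Their kernels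
  -- meet trivially, so the semidirect product is subdirect in `X × X`.
  let g : N ⋊[ρ] X →* X := SemidirectProduct.lift j (MonoidHom.id X) fun x => by
    ext n
    simpa using hρ x n
  refine hF.mem_of_ker_inf_ker SemidirectProduct.rightHom
    SemidirectProduct.rightHom_surjective g (fun x => ⟨SemidirectProduct.inr x, by simp [g]⟩)
    ?_ hX hX
  rw [eq_bot_iff]
  rintro ⟨n, x⟩ ⟨h1, h2⟩
  have h1' : x = 1 := h1
  subst h1'
  have h2' : j n * 1 = 1 := h2
  rw [mul_one, ← map_one j] at h2'
  rw [Subgroup.mem_bot, hj h2']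
  rfl

end FiniteGroupClass

/-- The surjection from a semidirect product to the one formed with the induced group of
automorphisms. -/
def SemidirectProduct.toRange {N X : Type*} [Group N] [Group X] (ρ : X →* MulAut N) :
    N ⋊[ρ] X →* N ⋊[ρ.range.subtype] ρ.range :=
  SemidirectProduct.map (MonoidHom.id N) ρ.rangeRestrict fun _ => rfl

theorem SemidirectProduct.toRange_surjective {N X : Type*} [Group N] [Group X]
    (ρ : X →* MulAut N) : Function.Surjective (SemidirectProduct.toRange ρ) := by
  rintro ⟨n, ⟨_, x, rfl⟩⟩
  exact ⟨⟨n, x⟩, rfl⟩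

/-! ### The Heisenberg extension and tensor products in saturated formations. -/

/-- The extension of `M₀ ⋊ Γ₀ × M₁ ⋊ Γ₁` by `N` attached to an equivariant bimultiplicative map
`M₀ × M₁ → N`: a group of generalized upper unitriangular matrices with operators. -/
@[ext]
structure HeisenbergGroup {Γ M₀ M₁ N : Type u} [Group Γ] [CommGroup M₀] [CommGroup M₁]
    [CommGroup N] (φ₀ : Γ →* MulAut M₀) (φ₁ : Γ →* MulAut M₁) (ρ : Γ →* MulAut N)
    (β : M₀ →* M₁ →* N) (hβ : ∀ a x y, ρ a (β x y) = β (φ₀ a x) (φ₁ a y)) where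
  op : Γ
  fst : M₀
  snd : M₁
  corner : N

namespace HeisenbergGroup

variable {Γ M₀ M₁ N : Type u} [Group Γ] [CommGroup M₀] [CommGroup M₁]
    [CommGroup N] {φ₀ : Γ →* MulAut M₀} {φ₁ : Γ →* MulAut M₁} {ρ : Γ →* MulAut N}
    {β : M₀ →* M₁ →* N} {hβ : ∀ a x y, ρ a (β x y) = β (φ₀ a x) (φ₁ a y)}

instance : Mul (HeisenbergGroup φ₀ φ₁ ρ β hβ) :=
  ⟨fun s t => ⟨s.op * t.op, s.fst * φ₀ s.op t.fst, s.snd * φ₁ s.op t.snd,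
    s.corner * ρ s.op t.corner * β s.fst (φ₁ s.op t.snd)⟩⟩

instance : One (HeisenbergGroup φ₀ φ₁ ρ β hβ) := ⟨⟨1, 1, 1, 1⟩⟩

instance : Inv (HeisenbergGroup φ₀ φ₁ ρ β hβ) :=
  ⟨fun s => ⟨s.op⁻¹, φ₀ s.op⁻¹ s.fst⁻¹, φ₁ s.op⁻¹ s.snd⁻¹,
    ρ s.op⁻¹ (s.corner⁻¹ * β s.fst s.snd)⟩⟩

variable (s t : HeisenbergGroup φ₀ φ₁ ρ β hβ)

@[simp] theorem mul_op : (s * t).op = s.op * t.op := rfl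
@[simp] theorem mul_fst : (s * t).fst = s.fst * φ₀ s.op t.fst := rfl
@[simp] theorem mul_snd : (s * t).snd = s.snd * φ₁ s.op t.snd := rfl
@[simp] theorem mul_corner :
    (s * t).corner = s.corner * ρ s.op t.corner * β s.fst (φ₁ s.op t.snd) := rfl
@[simp] theorem one_op : (1 : HeisenbergGroup φ₀ φ₁ ρ β hβ).op = 1 := rfl
@[simp] theorem one_fst : (1 : HeisenbergGroup φ₀ φ₁ ρ β hβ).fst = 1 := rfl
@[simp] theorem one_snd : (1 : HeisenbergGroup φ₀ φ₁ ρ β hβ).snd = 1 := rfl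
@[simp] theorem one_corner : (1 : HeisenbergGroup φ₀ φ₁ ρ β hβ).corner = 1 := rfl
@[simp] theorem inv_op : (s⁻¹).op = s.op⁻¹ := rfl
@[simp] theorem inv_fst : (s⁻¹).fst = φ₀ s.op⁻¹ s.fst⁻¹ := rfl
@[simp] theorem inv_snd : (s⁻¹).snd = φ₁ s.op⁻¹ s.snd⁻¹ := rfl
@[simp] theorem inv_corner : (s⁻¹).corner = ρ s.op⁻¹ (s.corner⁻¹ * β s.fst s.snd) := rfl

instance : Group (HeisenbergGroup φ₀ φ₁ ρ β hβ) :=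
  Group.ofLeftAxioms
    (by
      intro s t v
      ext
      · simp [mul_assoc]
      · simp [mul_assoc]
      · simp [mul_assoc]
      · simp only [mul_op, mul_fst, mul_snd, mul_corner, map_mul, MulAut.mul_apply,
          MonoidHom.mul_apply, hβ]
        ac_rfl)
    (by intro s; ext <;> simp)
    (by
      intro s
      ext
      · simp
      · simp
      · simp
      · simp only [mul_corner, inv_corner, inv_fst, inv_op, one_corner]
        generalize s.op⁻¹ = a
        simp [hβ])

instance [Finite Γ] [Finite M₀] [Finite M₁] [Finite N] :
    Finite (HeisenbergGroup φ₀ φ₁ ρ β hβ) :=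
  Finite.of_injective (fun s => (s.op, s.fst, s.snd, s.corner)) fun s t h => by
    simp only [Prod.mk.injEq] at h
    exact HeisenbergGroup.ext h.1 h.2.1 h.2.2.1 h.2.2.2

variable (φ₀ φ₁ ρ β hβ)

/-- The projection to the operators. -/
def opHom : HeisenbergGroup φ₀ φ₁ ρ β hβ →* Γ where
  toFun := op
  map_one' := rfl
  map_mul' _ _ := rfl

/-- The embedding of the corner. -/
def cornerHom : N →* HeisenbergGroup φ₀ φ₁ ρ β hβ where
  toFun n := ⟨1, 1, 1, n⟩
  map_one' := rfl
  map_mul' _ _ := by ext <;> simp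

theorem cornerHom_injective : Function.Injective (cornerHom φ₀ φ₁ ρ β hβ) :=
  fun _ _ h => congrArg corner h

theorem cornerHom_conj (s : HeisenbergGroup φ₀ φ₁ ρ β hβ) (n : N) :
    cornerHom φ₀ φ₁ ρ β hβ (ρ s.op n) = s * cornerHom φ₀ φ₁ ρ β hβ n * s⁻¹ := by
  rw [eq_mul_inv_iff_mul_eq]
  ext
  · simp [cornerHom]
  · simp [cornerHom]
  · simp [cornerHom]
  · simp [cornerHom, mul_comm]

/-- The corner consists of nongenerators, if it is generated by the values of `β`. -/
theorem range_cornerHom_le_frattini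
    (hgen : Subgroup.closure {z | ∃ x y, β x y = z} = ⊤) :
    (cornerHom φ₀ φ₁ ρ β hβ).range ≤ frattini (HeisenbergGroup φ₀ φ₁ ρ β hβ) := by
  set c := cornerHom φ₀ φ₁ ρ β hβ with hc
  have hn : c.range.Normal := ⟨by
    rintro _ ⟨n, rfl⟩ s
    exact ⟨_, cornerHom_conj φ₀ φ₁ ρ β hβ s n⟩⟩
  have hcen : ∀ (s : HeisenbergGroup φ₀ φ₁ ρ β hβ), s.op = 1 → ∀ n, s * c n = c n * s := by
    intro s hs n
    have := cornerHom_conj φ₀ φ₁ ρ β hβ s n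
    rw [hs, map_one, MulAut.one_apply, eq_mul_inv_iff_mul_eq] at this
    exact this.symm
  -- If a maximal subgroup `M` misses the corner, the elements `u`, `v` with commutator `β x y`
  -- agree modulo the corner with elements `m`, `m'` of `M`. The corner centralises everything with
  -- trivial operator, so `β x y` is also the commutator of `m` and `m'`, and lies in `M`.
  refine le_iInf₂ fun M hM => ?_
  by_contra hle
  have htop : M ⊔ c.range = ⊤ := hM.2 _ (left_lt_sup.mpr hle)
  have hmul : ∀ s : HeisenbergGroup φ₀ φ₁ ρ β hβ, ∃ m ∈ M, ∃ n, s = m * c n := by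
    intro s
    have hs : s ∈ M ⊔ c.range := htop ▸ Subgroup.mem_top s
    obtain ⟨m, hm, _, ⟨n, rfl⟩, rfl⟩ := Subgroup.mem_sup_of_normal_right.mp hs
    exact ⟨m, hm, n, rfl⟩
  apply hle
  rw [MonoidHom.range_eq_map, ← hgen, Subgroup.map_le_iff_le_comap, Subgroup.closure_le]
  rintro _ ⟨x, y, rfl⟩
  change c (β x y) ∈ M
  let u : HeisenbergGroup φ₀ φ₁ ρ β hβ := ⟨1, x, 1, 1⟩
  let v : HeisenbergGroup φ₀ φ₁ ρ β hβ := ⟨1, 1, y, 1⟩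
  obtain ⟨m, hm, n, hu⟩ := hmul u
  obtain ⟨m', hm', n', hv⟩ := hmul v
  have hmop : m.op = 1 := by
    have := congrArg op hu
    simpa [u, hc, cornerHom] using this.symm
  have hmop' : m'.op = 1 := by
    have := congrArg op hv
    simpa [v, hc, cornerHom] using this.symm
  have e1 : u * v = c (β x y) * (v * u) := by
    ext <;> simp [u, v, hc, cornerHom]
  have e2 : u * v = m * m' * (c n * c n') := by
    rw [hu, hv]
    calc m * c n * (m' * c n') = m * (c n * m') * c n' := by group
      _ = m * (m' * c n) * c n' := by rw [hcen m' hmop']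
      _ = _ := by group
  have e3 : v * u = m' * m * (c n * c n') := by
    rw [hu, hv]
    calc m' * c n' * (m * c n) = m' * (c n' * m) * c n := by group
      _ = m' * m * (c n' * c n) := by rw [← hcen m hmop]; group
      _ = _ := by rw [← map_mul, ← map_mul, mul_comm n' n]
  have e4 : c (β x y) = m * m' * (m' * m)⁻¹ := by
    have : c (β x y) = (u * v) * (v * u)⁻¹ := by rw [e1]; group
    rw [this, e2, e3]
    group
  rw [e4]
  exact mul_mem (mul_mem hm hm') (inv_mem (mul_mem hm' hm))

end HeisenbergGroup

/-- A saturated formation containing `M₀ ⋊ Γ₀` and `M₁ ⋊ Γ₁` contains the semidirect product with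
an equivariant image of their tensor product. -/
theorem FiniteGroupClass.IsSaturatedFormation.tensor_mem {F : FiniteGroupClass.{u}}
    (hF : F.IsSaturatedFormation) {Γ₀ Γ₁ M₀ M₁ N : Type u} [Group Γ₀] [Group Γ₁] [CommGroup M₀]
    [CommGroup M₁] [CommGroup N] [Finite N] (φ₀ : Γ₀ →* MulAut M₀) (φ₁ : Γ₁ →* MulAut M₁)
    (ρ : Γ₀ × Γ₁ →* MulAut N) (β : M₀ →* M₁ →* N)
    (hβ : ∀ a x y, ρ a (β x y) = β (φ₀ a.1 x) (φ₁ a.2 y))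
    (hgen : Subgroup.closure {z | ∃ x y, β x y = z} = ⊤)
    (h₀ : F.Mem (M₀ ⋊[φ₀] Γ₀)) (h₁ : F.Mem (M₁ ⋊[φ₁] Γ₁)) :
    F.Mem (N ⋊[ρ.range.subtype] ρ.range) := by
  have := F.finite_of_mem _ h₀
  have := F.finite_of_mem _ h₁
  have : Finite M₀ := Finite.of_injective _ (SemidirectProduct.inl_injective (φ := φ₀))
  have : Finite M₁ := Finite.of_injective _ (SemidirectProduct.inl_injective (φ := φ₁))
  have : Finite Γ₀ := Finite.of_injective _ (SemidirectProduct.inr_injective (φ := φ₀))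
  have : Finite Γ₁ := Finite.of_injective _ (SemidirectProduct.inr_injective (φ := φ₁))
  let φ₀' := φ₀.comp (MonoidHom.fst Γ₀ Γ₁)
  let φ₁' := φ₁.comp (MonoidHom.snd Γ₀ Γ₁)
  have hβ' : ∀ a x y, ρ a (β x y) = β (φ₀' a x) (φ₁' a y) := hβ
  let f : HeisenbergGroup φ₀' φ₁' ρ β hβ' →* (M₀ ⋊[φ₀] Γ₀) × (M₁ ⋊[φ₁] Γ₁) :=
    { toFun := fun s => (⟨s.fst, s.op.1⟩, ⟨s.snd, s.op.2⟩)
      map_one' := rfl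
      map_mul' := fun _ _ => rfl }
  have hf : Function.Surjective f := by
    rintro ⟨⟨x, a⟩, ⟨y, b⟩⟩
    exact ⟨⟨(a, b), x, y, 1⟩, rfl⟩
  have hker : f.ker ≤ (HeisenbergGroup.cornerHom φ₀' φ₁' ρ β hβ').range := by
    rintro ⟨⟨a, b⟩, x, y, z⟩ hs
    have h1 := congrArg Prod.fst (MonoidHom.mem_ker.mp hs)
    have h2 := congrArg Prod.snd (MonoidHom.mem_ker.mp hs)
    obtain rfl : x = 1 := congrArg SemidirectProduct.left h1
    obtain rfl : a = 1 := congrArg SemidirectProduct.right h1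
    obtain rfl : y = 1 := congrArg SemidirectProduct.left h2
    obtain rfl : b = 1 := congrArg SemidirectProduct.right h2
    exact ⟨z, rfl⟩
  have hX : F.Mem (HeisenbergGroup φ₀' φ₁' ρ β hβ') := hF.mem_of_surjective_of_ker_le f hf
    (hker.trans (HeisenbergGroup.range_cornerHom_le_frattini φ₀' φ₁' ρ β hβ' hgen))
    (hF.prod_mem h₀ h₁)
  -- The corner is a normal subgroup of the Heisenberg group on which conjugation is `ρ` of the
  -- operator. Form the semidirect product with the whole group, then divide out the kernel of the
  -- action.
  have h := hF.mem_of_surjective _ (SemidirectProduct.toRange_surjective _)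
    (hF.semidirect_mem (HeisenbergGroup.cornerHom φ₀' φ₁' ρ β hβ')
      (HeisenbergGroup.cornerHom_injective φ₀' φ₁' ρ β hβ')
      (ρ.comp (HeisenbergGroup.opHom φ₀' φ₁' ρ β hβ'))
      (HeisenbergGroup.cornerHom_conj φ₀' φ₁' ρ β hβ') hX)
  have hr : (ρ.comp (HeisenbergGroup.opHom φ₀' φ₁' ρ β hβ')).range = ρ.range := by
    apply le_antisymm
    · rintro _ ⟨s, rfl⟩
      exact ⟨_, rfl⟩
    · rintro _ ⟨a, rfl⟩
      exact ⟨⟨a, 1, 1, 1⟩, rfl⟩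
  rwa [hr] at h

/-! ### Schur's lemma for commutative irreducible groups of automorphisms. -/

section Schur

variable {N : Type*} [CommGroup N] {T : Subgroup (MulAut N)}

/-- `T` acts irreducibly on `N`. -/
def ActsIrreducibly {N : Type*} [Group N] (T : Subgroup (MulAut N)) : Prop :=
  ∀ S : Subgroup N, (∀ t ∈ T, ∀ x ∈ S, t x ∈ S) → S ≠ ⊥ → S = ⊤

/-- The set where two `T`-endomorphisms agree is `T`-invariant. -/
theorem ActsIrreducibly.eq_of_apply_eq (hT : ActsIrreducibly T) {d d' : N →* N}
    (hd : ∀ t ∈ T, ∀ x, d (t x) = t (d x)) (hd' : ∀ t ∈ T, ∀ x, d' (t x) = t (d' x))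
    {w : N} (hw : w ≠ 1) (h : d w = d' w) : d = d' := by
  have : d.eqLocus d' = ⊤ := by
    refine hT _ (fun t ht x hx => ?_) fun hb => hw ?_
    · change d (t x) = d' (t x)
      rw [hd t ht, hd' t ht, show d x = d' x from hx]
    · have : w ∈ d.eqLocus d' := h
      rwa [hb] at this
  ext x
  have hx : x ∈ d.eqLocus d' := this ▸ Subgroup.mem_top x
  exact hx

/-- The values at `w` of the `T`-endomorphisms form a `T`-invariant subgroup, because elements of
the commutative group `T` are themselves `T`-endomorphisms. With uniqueness, this identifies the
endomorphism ring with `N`. -/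
theorem ActsIrreducibly.exists_apply_eq (hT : ActsIrreducibly T)
    (hcomm : ∀ s ∈ T, ∀ t ∈ T, s * t = t * s) {w : N} (hw : w ≠ 1) (y : N) :
    ∃ d : N →* N, (∀ t ∈ T, ∀ x, d (t x) = t (d x)) ∧ d w = y := by
  let S : Subgroup N :=
    { carrier := {y | ∃ d : N →* N, (∀ t ∈ T, ∀ x, d (t x) = t (d x)) ∧ d w = y}
      one_mem' := ⟨1, by simp, rfl⟩
      mul_mem' := by
        rintro _ _ ⟨d, hd, rfl⟩ ⟨d', hd', rfl⟩
        exact ⟨d * d', fun t ht x => by simp [hd t ht, hd' t ht], rfl⟩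
      inv_mem' := by
        rintro _ ⟨d, hd, rfl⟩
        exact ⟨d⁻¹, fun t ht x => by simp [hd t ht], rfl⟩ }
  have hS : S = ⊤ := by
    refine hT S ?_ fun hb => hw ?_
    · rintro s hs _ ⟨d, hd, rfl⟩
      refine ⟨s.toMonoidHom.comp d, fun t ht x => ?_, rfl⟩
      change s (d (t x)) = t (s (d x))
      rw [hd t ht]
      exact DFunLike.congr_fun (hcomm s hs t ht) (d x)
    · have : w ∈ S := ⟨MonoidHom.id N, fun _ _ _ => rfl, rfl⟩
      rwa [hb] at this
  have hy : y ∈ S := hS ▸ Subgroup.mem_top y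
  exact hy

/-- A commutative irreducible group of automorphisms of `N` makes `N` a commutative algebra: there
is a bimultiplicative map, equivariant in each variable, with `w` as right identity. -/
theorem ActsIrreducibly.exists_bilinear (hT : ActsIrreducibly T)
    (hcomm : ∀ s ∈ T, ∀ t ∈ T, s * t = t * s) {w : N} (hw : w ≠ 1) :
    ∃ β : N →* N →* N, (∀ s ∈ T, ∀ x y, s (β x y) = β (s x) y) ∧
      (∀ s ∈ T, ∀ x y, s (β x y) = β x (s y)) ∧ ∀ x, β x w = x := by
  choose d hd hdw using hT.exists_apply_eq hcomm hw
  let δ : N →* N →* N :=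
    { toFun := d
      map_one' := hT.eq_of_apply_eq (hd 1) (by simp) hw (by rw [hdw]; rfl)
      map_mul' := fun x y => hT.eq_of_apply_eq (hd _)
        (fun t ht z => by simp [hd x t ht, hd y t ht]) hw (by
          rw [hdw, MonoidHom.mul_apply, hdw, hdw]) }
  -- The product of `x` and `y` is `d y x`, where `d y` is the unique `T`-endomorphism sending `w`
  -- to `y`.
  refine ⟨δ.flip, fun s hs x y => ((hd y) s hs x).symm, fun s hs x y => ?_, fun x => ?_⟩
  · have : s.toMonoidHom.comp (d y) = d (s y) := by
      refine hT.eq_of_apply_eq (fun t ht z => ?_) (hd _) hw ?_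
      · change s (d y (t z)) = t (s (d y z))
        rw [hd y t ht]
        exact DFunLike.congr_fun (hcomm s hs t ht) (d y z)
      · change s (d y w) = d (s y) w
        rw [hdw, hdw]
    exact DFunLike.congr_fun this x
  · have : d w = MonoidHom.id N := hT.eq_of_apply_eq (hd w) (fun _ _ _ => rfl) hw (hdw w)
    exact DFunLike.congr_fun this x

/-- An element of a commutative irreducible group of automorphisms with a nontrivial fixed point
is trivial. -/
theorem ActsIrreducibly.eq_one_of_apply_eq (hT : ActsIrreducibly T)
    (hcomm : ∀ s ∈ T, ∀ t ∈ T, s * t = t * s) {w : N} (hw : w ≠ 1) {s : MulAut N} (hs : s ∈ T)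
    (h : s w = w) : s = 1 := by
  have : s.toMonoidHom = MonoidHom.id N := hT.eq_of_apply_eq
    (fun t ht x => DFunLike.congr_fun (hcomm s hs t ht) x) (fun _ _ _ => rfl) hw h
  ext x
  exact DFunLike.congr_fun this x

end Schur

/-- Let a commutative group of automorphisms act irreducibly on `N`, and be generated by the images
of `Γ₀` and `Γ₁`. If each `Γᵢ` leaves invariant a nontrivial subgroup `Mᵢ` of `N` whose semidirect
product with the induced automorphism group lies in `F`, the same holds for `N`. -/
theorem FiniteGroupClass.IsSaturatedFormation.mem_of_actsIrreducibly {F : FiniteGroupClass.{u}}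
    (hF : F.IsSaturatedFormation) {Γ₀ Γ₁ M₀ M₁ N : Type u} [Group Γ₀] [Group Γ₁] [CommGroup M₀]
    [CommGroup M₁] [CommGroup N] [Finite N] [Nontrivial M₀] [Nontrivial M₁]
    {T : Subgroup (MulAut N)} (hT : ActsIrreducibly T) (hcomm : ∀ s ∈ T, ∀ t ∈ T, s * t = t * s)
    (ψ₀ : Γ₀ →* MulAut N) (ψ₁ : Γ₁ →* MulAut N) (hsup : ψ₀.range ⊔ ψ₁.range = T)
    (φ₀ : Γ₀ →* MulAut M₀) (φ₁ : Γ₁ →* MulAut M₁) (i₀ : M₀ →* N) (hi₀ : Function.Injective i₀)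
    (i₁ : M₁ →* N) (hi₁ : Function.Injective i₁) (h₀ : ∀ a x, i₀ (φ₀ a x) = ψ₀ a (i₀ x))
    (h₁ : ∀ a x, i₁ (φ₁ a x) = ψ₁ a (i₁ x))
    (hM₀ : F.Mem (M₀ ⋊[φ₀.range.subtype] φ₀.range))
    (hM₁ : F.Mem (M₁ ⋊[φ₁.range.subtype] φ₁.range)) :
    F.Mem (N ⋊[T.subtype] T) := by
  have hT₀ : ∀ a, ψ₀ a ∈ T := fun a => hsup ▸ Subgroup.mem_sup_left ⟨a, rfl⟩
  have hT₁ : ∀ a, ψ₁ a ∈ T := fun a => hsup ▸ Subgroup.mem_sup_right ⟨a, rfl⟩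
  obtain ⟨m₀, hm₀⟩ := exists_ne (1 : M₀)
  obtain ⟨m₁, hm₁⟩ := exists_ne (1 : M₁)
  have hw₀ : i₀ m₀ ≠ 1 := fun h => hm₀ (hi₀ (h.trans i₀.map_one.symm))
  have hw₁ : i₁ m₁ ≠ 1 := fun h => hm₁ (hi₁ (h.trans i₁.map_one.symm))
  obtain ⟨β, hβl, hβr, hβw⟩ := hT.exists_bilinear hcomm hw₁
  -- An operator trivial on `M₀` fixes a nontrivial element of `N`, hence is trivial on `N`. So the
  -- action on `N` factors through the automorphisms induced on `M₀`.
  have hker₀ : φ₀.rangeRestrict.ker ≤ ψ₀.ker := by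
    intro a ha
    rw [MonoidHom.ker_rangeRestrict, MonoidHom.mem_ker] at ha
    refine hT.eq_one_of_apply_eq hcomm hw₀ (hT₀ a) ?_
    rw [← h₀, ha, MulAut.one_apply]
  have hker₁ : φ₁.rangeRestrict.ker ≤ ψ₁.ker := by
    intro a ha
    rw [MonoidHom.ker_rangeRestrict, MonoidHom.mem_ker] at ha
    refine hT.eq_one_of_apply_eq hcomm hw₁ (hT₁ a) ?_
    rw [← h₁, ha, MulAut.one_apply]
  let ρ₀ : φ₀.range →* MulAut N :=
    φ₀.rangeRestrict.liftOfSurjective φ₀.rangeRestrict_surjective ⟨ψ₀, hker₀⟩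
  let ρ₁ : φ₁.range →* MulAut N :=
    φ₁.rangeRestrict.liftOfSurjective φ₁.rangeRestrict_surjective ⟨ψ₁, hker₁⟩
  have hρ₀ : ∀ a, ρ₀ (φ₀.rangeRestrict a) = ψ₀ a := fun a =>
    MonoidHom.liftOfRightInverse_comp_apply _ _ _ ⟨ψ₀, hker₀⟩ a
  have hρ₁ : ∀ a, ρ₁ (φ₁.rangeRestrict a) = ψ₁ a := fun a =>
    MonoidHom.liftOfRightInverse_comp_apply _ _ _ ⟨ψ₁, hker₁⟩ a
  have hc : ∀ a b, Commute (ρ₀ a) (ρ₁ b) := by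
    intro a b
    obtain ⟨a, rfl⟩ := φ₀.rangeRestrict_surjective a
    obtain ⟨b, rfl⟩ := φ₁.rangeRestrict_surjective b
    rw [hρ₀, hρ₁]
    exact hcomm _ (hT₀ a) _ (hT₁ b)
  let ρ := ρ₀.noncommCoprod ρ₁ hc
  have hr₀ : ρ₀.range = ψ₀.range := by
    apply le_antisymm
    · rintro _ ⟨a, rfl⟩
      obtain ⟨a, rfl⟩ := φ₀.rangeRestrict_surjective a
      exact ⟨a, (hρ₀ a).symm⟩
    · rintro _ ⟨a, rfl⟩
      exact ⟨_, hρ₀ a⟩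
  have hr₁ : ρ₁.range = ψ₁.range := by
    apply le_antisymm
    · rintro _ ⟨a, rfl⟩
      obtain ⟨a, rfl⟩ := φ₁.rangeRestrict_surjective a
      exact ⟨a, (hρ₁ a).symm⟩
    · rintro _ ⟨a, rfl⟩
      exact ⟨_, hρ₁ a⟩
  have hr : ρ.range = T := by
    rw [MonoidHom.noncommCoprod_range, hr₀, hr₁, hsup]
  let β' : M₀ →* M₁ →* N := ((β.flip.comp i₁).flip).comp i₀
  have hβ' : ∀ x y, β' x y = β (i₀ x) (i₁ y) := fun _ _ => rfl
  have heq : ∀ a x y, ρ a (β' x y) =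
      β' (φ₀.range.subtype a.1 x) (φ₁.range.subtype a.2 y) := by
    rintro ⟨a, b⟩ x y
    obtain ⟨a, rfl⟩ := φ₀.rangeRestrict_surjective a
    obtain ⟨b, rfl⟩ := φ₁.rangeRestrict_surjective b
    change ρ₀ _ (ρ₁ _ _) = β (i₀ (φ₀ a x)) (i₁ (φ₁ b y))
    rw [hρ₀, hρ₁, hβ', hβr _ (hT₁ b), hβl _ (hT₀ a), h₀, h₁]
  rw [← hr]
  refine hF.tensor_mem φ₀.range.subtype φ₁.range.subtype ρ β' heq ?_ hM₀ hM₁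
  -- The subgroup generated by the products is `T`-invariant, and it contains `i₀ m₀ = β (i₀ m₀) (i₁
  -- m₁)`, since `i₁ m₁` is the right identity.
  refine hT _ ?_ fun hb => hw₀ ?_
  · rw [← hr]
    rintro _ ⟨a, rfl⟩ x hx
    have : Subgroup.closure {z | ∃ x y, β' x y = z} ≤
        (Subgroup.closure {z | ∃ x y, β' x y = z}).comap (ρ a).toMonoidHom := by
      refine (Subgroup.closure_le _).mpr ?_
      rintro _ ⟨x, y, rfl⟩
      exact Subgroup.subset_closure ⟨_, _, (heq a x y).symm⟩
    exact this hx
  · have : i₀ m₀ ∈ Subgroup.closure {z | ∃ x y, β' x y = z} :=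
      Subgroup.subset_closure ⟨m₀, m₁, by rw [hβ', hβw]⟩
    rwa [hb] at this

/-! ### Supersoluble semidirect products. -/

theorem isSupersoluble_of_isCyclic_ker {A B : Type*} [Group A] [Group B] [IsCyclic B] (f : A →* B)
    (hf : Function.Surjective f) [IsCyclic f.ker] : IsSupersoluble A := by
  let S : ℕ → Subgroup A := fun i => match i with
    | 0 => ⊥
    | 1 => f.ker
    | _ => ⊤
  have hS : ∀ i, (S i).Normal := fun i => match i with
    | 0 => (inferInstance : (⊥ : Subgroup A).Normal)
    | 1 => (inferInstance : f.ker.Normal)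
    | _ + 2 => (inferInstance : (⊤ : Subgroup A).Normal)
  refine ⟨2, S, hS, rfl, rfl, fun i hi => ?_⟩
  interval_cases i
  · exact ⟨bot_le, isCyclic_of_surjective _
      (MonoidHom.subgroupMap_surjective (QuotientGroup.mk' (⊥ : Subgroup A)) f.ker)⟩
  · refine ⟨le_top, ?_⟩
    have : IsCyclic (A ⧸ f.ker) := isCyclic_of_surjective
      (QuotientGroup.quotientKerEquivOfSurjective f hf).symm (MulEquiv.surjective _)
    change IsCyclic (factorSubgroup (⊤ : Subgroup A) f.ker)
    infer_instance

/-- A group of prime order and its automorphism group are both cyclic. -/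
theorem isSupersoluble_semidirect_of_prime_card {M : Type*} [Group M] (hM : (Nat.card M).Prime)
    (R : Subgroup (MulAut M)) : IsSupersoluble (M ⋊[R.subtype] R) := by
  have : Fact (Nat.card M).Prime := ⟨hM⟩
  have : Finite M := Nat.finite_of_card_ne_zero hM.ne_zero
  have : IsCyclic M := isCyclic_of_prime_card (p := Nat.card M) rfl
  have : IsCyclic (MulAut M) := isCyclic_of_surjective (IsCyclic.mulAutMulEquiv M).symm
    (MulEquiv.surjective _)
  have : IsCyclic (SemidirectProduct.rightHom : M ⋊[R.subtype] R →* R).ker := by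
    rw [← SemidirectProduct.range_inl_eq_ker_rightHom]
    exact isCyclic_of_surjective _ SemidirectProduct.inl.rangeRestrict_surjective
  exact isSupersoluble_of_isCyclic_ker SemidirectProduct.rightHom
    SemidirectProduct.rightHom_surjective

/-! ### Invariant subgroups of prime order; inner automorphisms on minimal normal subgroups. -/

namespace Subgroup

section

variable {G : Type*} [Group G]

/-- The action by conjugation of `R` on an invariant subgroup `M`. -/
def IsConjInvariant.conjHom {R M : Subgroup G} (h : IsConjInvariant R M) : R →* MulAut M where
  toFun r :=
    { toFun := fun m => ⟨r * m * (r : G)⁻¹, h r r.2 m m.2⟩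
      invFun := fun m => ⟨(r : G)⁻¹ * m * r, by simpa using h r⁻¹ (inv_mem r.2) m m.2⟩
      left_inv := fun m => Subtype.ext (by simp [mul_assoc])
      right_inv := fun m => Subtype.ext (by simp [mul_assoc])
      map_mul' := fun m m' => Subtype.ext (by simp [mul_assoc]) }
  map_one' := by ext; simp
  map_mul' r s := by ext; simp [mul_assoc]

theorem prime_relIndex_zpowers [Finite G] {H : Subgroup G} {k : G} {q : ℕ} (hq : q.Prime)
    (hk : k ∉ H) (hkq : k ^ q ∈ H) : (H.relIndex (zpowers k)).Prime := by
  let S := H.subgroupOf (zpowers k)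
  let k' : zpowers k := ⟨k, mem_zpowers k⟩
  have hgen : ∀ x : zpowers k ⧸ S, x ∈ zpowers (k' : zpowers k ⧸ S) := by
    intro x
    induction x using QuotientGroup.induction_on with | _ x
    obtain ⟨_, i, rfl⟩ := x
    exact ⟨i, rfl⟩
  have hcard : Nat.card (zpowers k ⧸ S) = orderOf (k' : zpowers k ⧸ S) :=
    (orderOf_eq_card_of_forall_mem_zpowers hgen).symm
  have hdvd : orderOf (k' : zpowers k ⧸ S) ∣ q := by
    refine orderOf_dvd_of_pow_eq_one ?_
    rw [← QuotientGroup.mk_pow, QuotientGroup.eq_one_iff]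
    exact mem_subgroupOf.mpr hkq
  have hne : orderOf (k' : zpowers k ⧸ S) ≠ 1 := by
    rw [Ne, orderOf_eq_one_iff, QuotientGroup.eq_one_iff]
    exact fun h => hk (mem_subgroupOf.mp h)
  have : H.relIndex (zpowers k) = q := hcard.trans ((hq.eq_one_or_self_of_dvd _ hdvd).resolve_left hne)
  rwa [this]

/-- A factor of a mutually permutable product normalises a subgroup of prime order in each
nontrivial normal subgroup that it meets trivially. -/
theorem exists_prime_card_isConjInvariant [Finite G] {H K N : Subgroup G} (hN : N.Normal)
    (hNb : N ≠ ⊥) (hHK : MutuallyPermutes H K) (htop : H ⊔ K = ⊤) (hHN : H ⊓ N = ⊥) :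
    ∃ M ≤ N, IsConjInvariant H M ∧ (Nat.card M).Prime := by
  -- Factor a nontrivial `n ∈ N` as `ak` with `a ∈ H` and `k ∈ K`; then `k ∉ H`, as `H ∩ N = 1`.
  -- Replace `k` by prime powers of itself until the next one falls into `H`.
  obtain ⟨k, hkK, hkN, hkH, q, hq, hkq⟩ : ∃ k ∈ K, k ∈ H ⊔ N ∧ k ∉ H ∧
      ∃ q : ℕ, q.Prime ∧ k ^ q ∈ H := by
    obtain ⟨n, hn, hn1⟩ := N.bot_or_exists_ne_one.resolve_left hNb
    obtain ⟨a, ha, k, hk, e⟩ := hHK.permutes.exists_mul (htop ▸ mem_top n)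
    have hkN : k ∈ H ⊔ N := by
      have : k = a⁻¹ * n := by rw [e]; group
      rw [this]
      exact mul_mem (mem_sup_left (inv_mem ha)) (mem_sup_right hn)
    have hkH : k ∉ H := by
      intro hkH
      have : n ∈ H ⊓ N := ⟨e ▸ mul_mem ha hkH, hn⟩
      rw [hHN] at this
      exact hn1 this
    clear e
    induction ho : orderOf k using Nat.strong_induction_on generalizing k with
    | _ o ih =>
      have h1 : orderOf k ≠ 1 := fun h => hkH (by
        rw [orderOf_eq_one_iff.mp h]; exact one_mem H)
      have hp := Nat.minFac_prime h1
      by_cases hkq : k ^ (orderOf k).minFac ∈ H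
      · exact ⟨k, hk, hkN, hkH, _, hp, hkq⟩
      · refine ih _ ?_ _ (pow_mem hk _) (pow_mem hkN _) hkq rfl
        rw [orderOf_pow_of_dvd hp.ne_zero (Nat.minFac_dvd _), ← ho]
        exact Nat.div_lt_self (orderOf_pos k) hp.one_lt
  have hkle : zpowers k ≤ K := by rwa [zpowers_le]
  set Y := H ⊔ zpowers k with hY
  have hYle : Y ≤ H ⊔ N := sup_le le_sup_left (by rwa [zpowers_le])
  refine ⟨Y ⊓ N, inf_le_right, (IsConjInvariant.of_le le_sup_left).inf (hN.isConjInvariant H), ?_⟩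
  have hHY : H ≤ Y := le_sup_left
  have hzY : zpowers k ≤ Y := le_sup_right
  -- The index of `H` in `Y` is computed twice: from `Y = ⟨k⟩H` it is prime, and from `Y = H(Y ∩ N)`
  -- with `H ∩ N = 1` it is the order of `Y ∩ N`.
  have h1 : H.relIndex (zpowers k) = (H.subgroupOf Y).index := by
    rw [← relIndex_subgroupOf hzY]
    refine relIndex_eq_index_of_exists_mul ?_
    rintro ⟨y, hy⟩
    obtain ⟨l, hl, a, ha, rfl⟩ := (hHK.left _ hkle).exists_mul' hy
    exact ⟨⟨l, hzY hl⟩, hl, ⟨a, hHY ha⟩, ha, rfl⟩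
  have h2 : H.relIndex (Y ⊓ N) = (H.subgroupOf Y).index := by
    rw [← relIndex_subgroupOf (inf_le_left : Y ⊓ N ≤ Y)]
    refine relIndex_eq_index_of_exists_mul ?_
    rintro ⟨y, hy⟩
    obtain ⟨a, ha, n, hn, rfl⟩ := mem_sup_of_normal_right.mp (hYle hy)
    have hnY : n ∈ Y := by simpa using Y.mul_mem (Y.inv_mem (hHY ha)) hy
    have hnY' : a * n * a⁻¹ ∈ Y := Y.mul_mem hy (Y.inv_mem (hHY ha))
    exact ⟨⟨a * n * a⁻¹, hnY'⟩, ⟨hnY', hN.conj_mem n hn a⟩, ⟨a, hHY ha⟩, ha,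
      Subtype.ext (by simp)⟩
  have h3 : H.relIndex (Y ⊓ N) = Nat.card (Y ⊓ N : Subgroup G) := by
    rw [← inf_relIndex_right, show H ⊓ (Y ⊓ N) = ⊥ from
      eq_bot_iff.mpr (hHN ▸ inf_le_inf_left H inf_le_right), relIndex_bot_left]
  rw [← h3, h2, ← h1]
  exact prime_relIndex_zpowers hq hkH hkq

theorem IsMinInvariant.map_conj {P W : Subgroup G} (hP : P.Normal) (hW : IsMinInvariant P W)
    (q : G) : IsMinInvariant P (W.map (MulAut.conj q).toMonoidHom) := by
  have key : ∀ {L : Subgroup G}, IsConjInvariant P L → ∀ q : G,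
      IsConjInvariant P (L.map (MulAut.conj q).toMonoidHom) := by
    intro L hL q g hg x hx
    rw [map_conj_eq] at hx ⊢
    have h1 : q⁻¹ * g * q ∈ P := by simpa using hP.conj_mem g hg q⁻¹
    have e : q⁻¹ * (g * x * g⁻¹) * q = q⁻¹ * g * q * (q⁻¹ * x * q) * (q⁻¹ * g * q)⁻¹ := by group
    rw [e]
    exact hL _ h1 _ hx
  have hmap : ∀ L : Subgroup G, ∀ q : G,
      (L.map (MulAut.conj q⁻¹).toMonoidHom).map (MulAut.conj q).toMonoidHom = L := by
    intro L q
    ext x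
    rw [map_conj_eq, map_conj_eq]
    simp [mul_assoc]
  have hb : ∀ L : Subgroup G, ∀ q : G, L.map (MulAut.conj q).toMonoidHom = ⊥ → L = ⊥ :=
    fun L q => (map_eq_bot_iff_of_injective L (MulAut.conj q).injective).mp
  refine ⟨fun h => hW.ne_bot (hb W q h), key hW.inv q, fun L hL hLi hLb => ?_⟩
  have h1 : L.map (MulAut.conj q⁻¹).toMonoidHom ≤ W := by
    rintro x hx
    rw [map_conj_eq, inv_inv] at hx
    have := map_conj_eq.mp (hL hx)
    simpa [mul_assoc] using this
  have h2 := hW.eq_of_le _ h1 (key hLi q⁻¹) fun h => hLb (hb L q⁻¹ h)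
  rw [← h2, hmap]

/-- If each element of the normal subgroup `P` induces inner automorphisms on the minimal
`P`-invariant subgroups of the minimal normal subgroup `N`, it induces inner automorphisms on `N`. -/
theorem IsMinInvariant.exists_conj_eq [Finite G] {P N : Subgroup G} (hP : P.Normal)
    (hN : IsMinInvariant ⊤ N) (hNP : N ≤ P)
    (hinner : ∀ W ≤ N, IsMinInvariant P W → ∀ g ∈ P, ∃ w ∈ W, ∀ x ∈ W,
      g * x * g⁻¹ = w * x * w⁻¹) :
    ∀ g ∈ P, ∃ n ∈ N, ∀ x ∈ N, g * x * g⁻¹ = n * x * n⁻¹ := by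
  have hNn : N.Normal := isConjInvariant_top_iff.mp hN.inv
  -- Take `Y` maximal with the inner property. If `Y ≠ N`, some conjugate `V` of a minimal
  -- `P`-invariant subgroup is not in `Y`; then `Y ∩ V = 1`, the two commute, and `YV` contradicts
  -- maximality.
  obtain ⟨Y, hY⟩ := (Set.toFinite {Y : Subgroup G | Y ≤ N ∧ IsConjInvariant P Y ∧
    ∀ g ∈ P, ∃ n ∈ Y, ∀ x ∈ Y, g * x * g⁻¹ = n * x * n⁻¹}).exists_maximal
    ⟨⊥, bot_le, fun g _ x hx => by rw [mem_bot] at hx ⊢; simp [hx],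
      fun g _ => ⟨1, one_mem _, fun x hx => by rw [mem_bot] at hx; simp [hx]⟩⟩
  obtain ⟨hYN, hYP, hYi⟩ := hY.prop
  by_cases hYe : Y = N
  · rwa [hYe] at hYi
  exfalso
  obtain ⟨W, hWN, hW⟩ := exists_isMinInvariant (hNn.isConjInvariant P) hN.ne_bot
  obtain ⟨q, hq⟩ : ∃ q : G, ¬ W.map (MulAut.conj q).toMonoidHom ≤ Y := by
    by_contra! hall
    apply hYe
    let M : Subgroup G := closure {x | ∃ g : G, ∃ w ∈ W, x = g * w * g⁻¹}
    have hM : IsConjInvariant ⊤ M := isConjInvariant_closure <| by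
      rintro r - _ ⟨g, w, hw, rfl⟩
      exact subset_closure ⟨r * g, w, hw, by group⟩
    have hMY : M ≤ Y := (closure_le _).mpr <| by
      rintro _ ⟨g, w, hw, rfl⟩
      exact hall g ⟨w, hw, rfl⟩
    have hWM : W ≤ M := fun w hw => subset_closure ⟨1, w, hw, by group⟩
    have := hN.eq_of_le M (hMY.trans hYN) hM fun hb => hW.ne_bot (eq_bot_iff.mpr (hb ▸ hWM))
    exact le_antisymm hYN (this ▸ hMY)
  set V := W.map (MulAut.conj q).toMonoidHom
  have hV : IsMinInvariant P V := hW.map_conj hP q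
  have hVN : V ≤ N := by
    rintro _ ⟨w, hw, rfl⟩
    exact hNn.conj_mem w (hWN hw) q
  have hYV : Y ⊓ V = ⊥ := by
    by_contra hb
    have := hV.eq_of_le (Y ⊓ V) inf_le_right (hYP.inf hV.inv) hb
    exact hq (this ▸ inf_le_left)
  have hcomm : ∀ y ∈ Y, ∀ v ∈ V, y * v = v * y := fun y hy v hv =>
    commute_of_inf_eq_bot (hV.inv.mono (hYN.trans hNP)) (hYP.mono (hVN.trans hNP)) hYV hy hv
  have hmem : Y ⊔ V ≤ N ∧ IsConjInvariant P (Y ⊔ V) ∧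
      ∀ g ∈ P, ∃ n ∈ Y ⊔ V, ∀ x ∈ Y ⊔ V, g * x * g⁻¹ = n * x * n⁻¹ := by
    refine ⟨sup_le hYN hVN, hYP.sup_right hV.inv, fun g hg => ?_⟩
    obtain ⟨n, hn, hgn⟩ := hYi g hg
    obtain ⟨v, hv, hgv⟩ : ∃ v ∈ V, ∀ x ∈ V, g * x * g⁻¹ = v * x * v⁻¹ := hinner V hVN hV g hg
    refine ⟨n * v, mul_mem (mem_sup_left hn) (mem_sup_right hv), fun x hx => ?_⟩
    have hle : Y ⊔ V ≤ (MulAut.conj g).toMonoidHom.eqLocus (MulAut.conj (n * v)).toMonoidHom := by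
      refine sup_le (fun y hy => ?_) (fun w hw => ?_)
      · change g * y * g⁻¹ = n * v * y * (n * v)⁻¹
        rw [hgn y hy]
        calc n * y * n⁻¹ = n * (y * v) * v⁻¹ * n⁻¹ := by group
          _ = _ := by rw [hcomm y hy v hv]; group
      · change g * w * g⁻¹ = n * v * w * (n * v)⁻¹
        rw [hgv w hw]
        have h1 : v * w * v⁻¹ ∈ V := V.mul_mem (V.mul_mem hv hw) (V.inv_mem hv)
        calc v * w * v⁻¹ = (v * w * v⁻¹) * n * n⁻¹ := by group
          _ = _ := by rw [← hcomm n hn _ h1]; group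
    exact hle hx
  exact hq (le_sup_right.trans (hY.le_of_ge hmem le_sup_left))

end

end Subgroup

/-! ### Transport of semidirect products. -/

namespace SemidirectProduct

variable {M M' X : Type*} [Group M] [Group M'] [Group X]

/-- The semidirect product with `X / ker φ` is the one with the image of `φ`. -/
noncomputable def kerLiftEquivRange (φ : X →* MulAut M) :
    M ⋊[QuotientGroup.kerLift φ] (X ⧸ φ.ker) ≃* M ⋊[φ.range.subtype] φ.range :=
  SemidirectProduct.congr (MulEquiv.refl M) (QuotientGroup.quotientKerEquivRange φ) fun x => by
    induction x using QuotientGroup.induction_on with | _ x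
    rfl

/-- Transport of a semidirect product with a group of automorphisms along an isomorphism. -/
def mapSubgroupEquiv (e : M ≃* M') (R : Subgroup (MulAut M)) :
    M ⋊[R.subtype] R ≃*
      M' ⋊[(R.map (MulAut.congr e).toMonoidHom).subtype] (R.map (MulAut.congr e).toMonoidHom) :=
  SemidirectProduct.congr e ((MulAut.congr e).subgroupMap R) fun r => by
    ext m
    change e (r.1 m) = e (r.1 (e.symm (e m)))
    rw [e.symm_apply_apply]

end SemidirectProduct

theorem FiniteGroupClass.mem_semidirect_range_congr {F : FiniteGroupClass.{u}}
    {M M' : Type u} {X : Type*} {X' : Type*} [Group M] [Group M'] [Group X] [Group X'] (e : M ≃* M')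
    (φ : X →* MulAut M) (φ' : X' →* MulAut M') (f : X →* X') (hf : Function.Surjective f)
    (h : ∀ x m, e (φ x m) = φ' (f x) (e m)) (hM : F.Mem (M ⋊[φ.range.subtype] φ.range)) :
    F.Mem (M' ⋊[φ'.range.subtype] φ'.range) := by
  have hr : φ.range.map (MulAut.congr e).toMonoidHom = φ'.range := by
    have key : ∀ x, MulAut.congr e (φ x) = φ' (f x) := by
      intro x
      ext m
      change e (φ x (e.symm m)) = _
      rw [h, e.apply_symm_apply]
    apply le_antisymm
    · rintro _ ⟨_, ⟨x, rfl⟩, rfl⟩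
      exact ⟨f x, (key x).symm⟩
    · rintro _ ⟨x, rfl⟩
      obtain ⟨x, rfl⟩ := hf x
      exact ⟨_, ⟨x, rfl⟩, key x⟩
  rw [← hr]
  exact F.mem_of_mulEquiv _ _ (SemidirectProduct.mapSubgroupEquiv e _) hM

/-! ### Chief factors as minimal invariant subgroups of images. -/

section Pullback

open Subgroup

variable {X Y : Type*} [Group X] [Group Y]

/-- A minimal invariant subgroup in the image of a homomorphism is a chief factor of the domain. -/
theorem exists_chiefFactor_mulEquiv (f : X →* Y) {M : Subgroup Y} (hM : M ≤ f.range)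
    (hmin : IsMinInvariant f.range M) :
    ∃ _ : (M.comap f).Normal, IsChiefFactor (M.comap f) f.ker ∧
      ∃ e : factorSubgroup (M.comap f) f.ker ≃* M,
        ∀ x n, (e (factorAction (M.comap f) f.ker x n) : Y) = f x * e n * (f x)⁻¹ := by
  have hn : (M.comap f).Normal := ⟨fun m hm x => by
    rw [mem_comap, map_mul, map_mul, map_inv]
    exact hmin.inv _ ⟨x, rfl⟩ _ hm⟩
  have hle : f.ker ≤ M.comap f := fun x hx => by
    rw [mem_comap, MonoidHom.mem_ker.mp hx]
    exact one_mem M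
  have hmapM : (M.comap f).map f = M := by rw [map_comap_eq, inf_eq_right.mpr hM]
  refine ⟨hn, ⟨lt_of_le_of_ne hle fun h => hmin.ne_bot ?_, fun L hL hKL hLM => ?_⟩, ?_⟩
  · rw [← hmapM, ← h]
    exact (Subgroup.map_eq_bot_iff _).mpr le_rfl
  · have hL' : L.map f ≤ M := map_le_iff_le_comap.mpr hLM
    have hLi : IsConjInvariant f.range (L.map f) := by
      rintro _ ⟨x, rfl⟩ _ ⟨l, hl, rfl⟩
      exact ⟨x * l * x⁻¹, hL.conj_mem l hl x, by simp⟩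
    by_cases hb : L.map f = ⊥
    · exact .inl (le_antisymm ((Subgroup.map_eq_bot_iff _).mp hb) hKL)
    · right
      rw [← hmin.eq_of_le _ hL' hLi hb, comap_map_eq, sup_eq_left.mpr hKL]
  · let j := QuotientGroup.kerLift f
    have hj : (factorSubgroup (M.comap f) f.ker).map j = M := by
      rw [map_map]
      exact hmapM
    refine ⟨(equivMapOfInjective _ j (QuotientGroup.kerLift_injective f)).trans
      (MulEquiv.subgroupCongr hj), fun x n => ?_⟩
    change j (QuotientGroup.mk' f.ker x * n * (QuotientGroup.mk' f.ker x)⁻¹) = f x * j n * (f x)⁻¹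
    rw [map_mul, map_mul, map_inv]
    rfl

theorem IsQuasinilpotent.exists_conj_eq (hX : IsQuasinilpotent X) (f : X →* Y) {M : Subgroup Y}
    (hM : M ≤ f.range) (hmin : IsMinInvariant f.range M) :
    ∀ g ∈ f.range, ∃ w ∈ M, ∀ x ∈ M, g * x * g⁻¹ = w * x * w⁻¹ := by
  rintro _ ⟨g, rfl⟩
  obtain ⟨hn, hc, e, he⟩ := exists_chiefFactor_mulEquiv f hM hmin
  obtain ⟨x, hx⟩ := hX.2 _ _ hc g
  refine ⟨e x, (e x).2, fun y hy => ?_⟩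
  have h := he g (e.symm ⟨y, hy⟩)
  rw [hx, MulAut.conj_apply, map_mul, map_mul, map_inv, e.apply_symm_apply] at h
  exact h.symm

theorem isMulCommutative_iff_of_mulEquiv {A B : Type*} [Group A] [Group B] (e : A ≃* B) :
    IsMulCommutative A ↔ ∀ x y : B, x * y = y * x := by
  rw [isMulCommutative_iff]
  constructor
  · intro h x y
    apply e.symm.injective
    rw [map_mul, map_mul, h]
  · intro h x y
    apply e.injective
    rw [map_mul, map_mul, h]

end Pullback

/-! ### Consequences of the `ca`-`F` condition; the abelian case. -/

section Ca

open Subgroup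

variable {F : FiniteGroupClass.{u}} {X Y : Type u} [Group X] [Group Y]

theorem FiniteGroupClass.IsCaGroup.hasSimpleMinInvariant (hX : F.IsCaGroup X) (f : X →* Y) :
    HasSimpleMinInvariant f.range := by
  intro M hM hmin hab L hL hLi hLb
  obtain ⟨hn, hc, e, he⟩ := exists_chiefFactor_mulEquiv f hM hmin
  have hs := hX.simple_of_nonabelian _ _ hc fun h => hab fun x hx y hy =>
    congrArg Subtype.val ((isMulCommutative_iff_of_mulEquiv e).mp h ⟨x, hx⟩ ⟨y, hy⟩)
  have : IsSimpleGroup M := e.symm.isSimpleGroup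
  have hLn : (L.subgroupOf M).Normal :=
    ⟨fun l hl m => mem_subgroupOf.mpr (hLi m m.2 l (mem_subgroupOf.mp hl))⟩
  rcases hLn.eq_bot_or_eq_top with h | h
  · rw [subgroupOf_eq_bot, disjoint_iff, inf_eq_left.mpr hL] at h
    exact absurd h hLb
  · exact le_antisymm hL (subgroupOf_eq_top.mp h)

theorem FiniteGroupClass.IsCaGroup.mem_of_isMinInvariant (hX : F.IsCaGroup X) (f : X →* Y)
    {M : Subgroup Y} (hM : M ≤ f.range) (hmin : IsMinInvariant f.range M)
    (hab : ∀ x ∈ M, ∀ y ∈ M, x * y = y * x) :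
    F.Mem (M ⋊[hmin.inv.conjHom.range.subtype] hmin.inv.conjHom.range) := by
  obtain ⟨hn, hc, e, he⟩ := exists_chiefFactor_mulEquiv f hM hmin
  have hs := hX.central_of_abelian _ _ hc ((isMulCommutative_iff_of_mulEquiv e).mpr
    fun x y => Subtype.ext (hab x x.2 y y.2))
  refine FiniteGroupClass.mem_semidirect_range_congr e (factorAction (M.comap f) f.ker) _
    f.rangeRestrict f.rangeRestrict_surjective (fun x m => Subtype.ext (he x m)) ?_
  exact F.mem_of_mulEquiv _ _ (SemidirectProduct.kerLiftEquivRange _) hs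

/-- A factor of a mutually permutable product leaves invariant a nontrivial subgroup of each
nontrivial abelian normal subgroup `N`, on which it acts centrally for `F`. -/
theorem exists_isConjInvariant_mem
    (hU : ∀ (A : Type u) [Group A] [Finite A], IsSupersoluble A → F.Mem A) [Finite Y]
    {H K N : Subgroup Y} (hN : N.Normal) (hNb : N ≠ ⊥) (hHK : MutuallyPermutes H K)
    (htop : H ⊔ K = ⊤)
    (hH : ∀ M ≤ H, ∀ hM : IsMinInvariant H M, (∀ x ∈ M, ∀ y ∈ M, x * y = y * x) →
      F.Mem (M ⋊[hM.inv.conjHom.range.subtype] hM.inv.conjHom.range))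
    (hab : ∀ x ∈ N, ∀ y ∈ N, x * y = y * x) :
    ∃ M ≤ N, M ≠ ⊥ ∧ ∃ hM : IsConjInvariant H M,
      F.Mem (M ⋊[hM.conjHom.range.subtype] hM.conjHom.range) := by
  by_cases hHN : H ⊓ N = ⊥
  · obtain ⟨M, hMN, hM, hp⟩ := exists_prime_card_isConjInvariant hN hNb hHK htop hHN
    refine ⟨M, hMN, fun hb => ?_, hM, ?_⟩
    · rw [hb, card_bot] at hp
      exact Nat.not_prime_one hp
    · have : Finite (M ⋊[hM.conjHom.range.subtype] hM.conjHom.range) :=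
        Finite.of_equiv _ SemidirectProduct.equivProd.symm
      exact hU _ (isSupersoluble_semidirect_of_prime_card hp _)
  · obtain ⟨M, hMle, hM⟩ := exists_isMinInvariant
      ((IsConjInvariant.of_le le_rfl).inf (hN.isConjInvariant H)) hHN
    have hMN := hMle.trans inf_le_right
    exact ⟨M, hMN, hM.ne_bot, hM.inv, hH M (hMle.trans inf_le_left) hM
      fun x hx y hy => hab x (hMN hx) y (hMN hy)⟩

/-- The action on `N` is irreducible by minimality and commutative because `Y'` centralises `N`. The
images of `H` and `K` generate it, so `mem_of_actsIrreducibly` applies. -/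
theorem mem_conjNormal_range_of_mutuallyPermutes (hF : F.IsSaturatedFormation)
    (hU : ∀ (A : Type u) [Group A] [Finite A], IsSupersoluble A → F.Mem A) [Finite Y]
    {H K N : Subgroup Y} [hN : N.Normal] (hmin : IsMinInvariant ⊤ N)
    (hab : ∀ x ∈ N, ∀ y ∈ N, x * y = y * x)
    (hcen : ∀ g ∈ commutator Y, ∀ x ∈ N, g * x * g⁻¹ = x)
    (hHK : MutuallyPermutes H K) (htop : H ⊔ K = ⊤)
    (hH : ∀ M ≤ H, ∀ hM : IsMinInvariant H M, (∀ x ∈ M, ∀ y ∈ M, x * y = y * x) →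
      F.Mem (M ⋊[hM.inv.conjHom.range.subtype] hM.inv.conjHom.range))
    (hK : ∀ M ≤ K, ∀ hM : IsMinInvariant K M, (∀ x ∈ M, ∀ y ∈ M, x * y = y * x) →
      F.Mem (M ⋊[hM.inv.conjHom.range.subtype] hM.inv.conjHom.range)) :
    F.Mem (N ⋊[(MulAut.conjNormal (H := N)).range.subtype] (MulAut.conjNormal (H := N)).range) := by
  obtain ⟨M₀, hM₀N, hM₀b, hM₀, hm₀⟩ := exists_isConjInvariant_mem hU hN
    hmin.ne_bot hHK htop hH hab
  obtain ⟨M₁, hM₁N, hM₁b, hM₁, hm₁⟩ := exists_isConjInvariant_mem hU hN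
    hmin.ne_bot hHK.symm (sup_comm H K ▸ htop) hK hab
  let _ : CommGroup N := { (inferInstance : Group N) with
    mul_comm := fun x y => Subtype.ext (hab x x.2 y y.2) }
  let _ : CommGroup M₀ := { (inferInstance : Group M₀) with
    mul_comm := fun x y => Subtype.ext (hab x (hM₀N x.2) y (hM₀N y.2)) }
  let _ : CommGroup M₁ := { (inferInstance : Group M₁) with
    mul_comm := fun x y => Subtype.ext (hab x (hM₁N x.2) y (hM₁N y.2)) }
  have : Nontrivial M₀ := (nontrivial_iff_ne_bot M₀).mpr hM₀b
  have : Nontrivial M₁ := (nontrivial_iff_ne_bot M₁).mpr hM₁b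
  have hirr : ActsIrreducibly (MulAut.conjNormal (H := N)).range := by
    intro S hS hSb
    have hSi : IsConjInvariant ⊤ (S.map N.subtype) := by
      rintro g - _ ⟨x, hx, rfl⟩
      exact ⟨_, hS _ ⟨g, rfl⟩ x hx, rfl⟩
    have := hmin.eq_of_le _ (map_subtype_le S) hSi
      fun h => hSb ((map_eq_bot_iff_of_injective S N.subtype_injective).mp h)
    apply map_injective N.subtype_injective
    rw [this, ← MonoidHom.range_eq_map, range_subtype]
  have hcomm : ∀ s ∈ (MulAut.conjNormal (H := N)).range, ∀ t ∈ (MulAut.conjNormal (H := N)).range,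
      s * t = t * s := by
    rintro _ ⟨g, rfl⟩ _ ⟨h, rfl⟩
    rw [← commutatorElement_eq_one_iff_mul_comm, ← map_commutatorElement]
    ext x
    exact hcen _ (commutator_mem_commutator (mem_top g) (mem_top h)) x x.2
  have hsup : (hN.isConjInvariant H).conjHom.range ⊔ (hN.isConjInvariant K).conjHom.range =
      (MulAut.conjNormal (H := N)).range := by
    apply le_antisymm
    · refine sup_le ?_ ?_
      · rintro _ ⟨g, rfl⟩
        exact ⟨g, by ext; rfl⟩
      · rintro _ ⟨g, rfl⟩
        exact ⟨g, by ext; rfl⟩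
    · rw [MonoidHom.range_eq_map, ← htop, Subgroup.map_sup]
      refine sup_le_sup ?_ ?_
      · rintro _ ⟨g, hg, rfl⟩
        exact ⟨⟨g, hg⟩, by ext; rfl⟩
      · rintro _ ⟨g, hg, rfl⟩
        exact ⟨⟨g, hg⟩, by ext; rfl⟩
  exact hF.mem_of_actsIrreducibly hirr hcomm (hN.isConjInvariant H).conjHom
    (hN.isConjInvariant K).conjHom hsup hM₀.conjHom hM₁.conjHom (inclusion hM₀N)
    (inclusion_injective hM₀N) (inclusion hM₁N) (inclusion_injective hM₁N)
    (fun _ _ => rfl) (fun _ _ => rfl) hm₀ hm₁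

end Ca

/-! ### Reduction to minimal normal subgroups of quotients. -/

section Main

open Subgroup

theorem Subgroup.MutuallyPermutes.of_isMutuallyPermutableProduct {G : Type u} [Group G]
    {H K : Subgroup G} (h : IsMutuallyPermutableProduct H K) : MutuallyPermutes H K := by
  have key : ∀ {A L : Subgroup G}, (A : Set G) * L = L * A → Permutes A L := by
    intro A L h a ha l hl
    have : a * l ∈ (L : Set G) * A := h ▸ Set.mul_mem_mul ha hl
    obtain ⟨l', hl', a', ha', e⟩ := this
    exact ⟨l', hl', a', ha', e.symm⟩
  exact ⟨fun L hL => key (h.left_permutes L hL), fun L hL => key (h.right_permutes L hL)⟩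

theorem IsMutuallyPermutableProduct.sup_eq_top {G : Type u} [Group G]
    {H K : Subgroup G} (h : IsMutuallyPermutableProduct H K) : H ⊔ K = ⊤ := by
  rw [eq_top_iff]
  intro g _
  have : g ∈ (H : Set G) * K := h.mul_eq_univ ▸ Set.mem_univ g
  obtain ⟨a, ha, b, hb, rfl⟩ := this
  exact mul_mem (mem_sup_left ha) (mem_sup_right hb)

theorem IsChiefFactor.isMinInvariant {G : Type u} [Group G] {A B : Subgroup G} [hA : A.Normal]
    [B.Normal] (h : IsChiefFactor A B) : IsMinInvariant ⊤ (factorSubgroup A B) := by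
  have hc : (factorSubgroup A B).comap (QuotientGroup.mk' B) = A := by
    rw [comap_map_eq, QuotientGroup.ker_mk', sup_eq_left.mpr h.1.le]
  refine ⟨fun hb => ?_, isConjInvariant_top_iff.mpr inferInstance, fun L hL hLi hLb => ?_⟩
  · rw [Subgroup.map_eq_bot_iff, QuotientGroup.ker_mk'] at hb
    exact h.1.not_ge hb
  · have hLn := isConjInvariant_top_iff.mp hLi
    have hs : (L.comap (QuotientGroup.mk' B)).map (QuotientGroup.mk' B) = L :=
      map_comap_eq_self_of_surjective (QuotientGroup.mk'_surjective B) L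
    rcases h.2 (L.comap (QuotientGroup.mk' B)) (hLn.comap _)
      (fun x hx => by
        rw [mem_comap, QuotientGroup.mk'_apply, (QuotientGroup.eq_one_iff x).mpr hx]
        exact one_mem L)
      (hc ▸ comap_mono hL) with e | e
    · rw [e] at hs
      refine absurd ?_ hLb
      rw [← hs, Subgroup.map_eq_bot_iff, QuotientGroup.ker_mk']
    · rw [e] at hs
      exact hs.symm

theorem range_comp_commutator_subtype {G Q : Type*} [Group G] [Group Q] {f : G →* Q}
    (hf : Function.Surjective f) : (f.comp (commutator G).subtype).range = commutator Q := by
  rw [MonoidHom.range_comp, range_subtype, commutator_def, map_commutator,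
    ← MonoidHom.range_eq_map, MonoidHom.range_eq_top.mpr hf, ← commutator_def]

/-- If the derived subgroup induces inner automorphisms on its minimal normal subgroups, it
centralises the abelian minimal normal subgroups. -/
theorem commutator_centralizes_of_isMinInvariant {Q : Type*} [Group Q] [Finite Q] {N : Subgroup Q}
    (hN : IsMinInvariant ⊤ N) (hab : ∀ x ∈ N, ∀ y ∈ N, x * y = y * x)
    (hinner : ∀ W ≤ commutator Q, IsMinInvariant (commutator Q) W → ∀ g ∈ commutator Q,
      ∃ w ∈ W, ∀ x ∈ W, g * x * g⁻¹ = w * x * w⁻¹) :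
    ∀ g ∈ commutator Q, ∀ x ∈ N, g * x * g⁻¹ = x := by
  have hNn : N.Normal := isConjInvariant_top_iff.mp hN.inv
  have hP : (commutator Q).Normal := inferInstance
  by_cases hb : N ⊓ commutator Q = ⊥
  · intro g _ x hx
    have h1 : ⁅g, x⁆ ∈ N ⊓ commutator Q :=
      ⟨N.mul_mem (hNn.conj_mem x hx g) (N.inv_mem hx),
        commutator_mem_commutator (mem_top g) (mem_top x)⟩
    rw [hb, mem_bot, commutatorElement_eq_one_iff_mul_comm] at h1
    rw [h1, mul_inv_cancel_right]
  have hNP : N ≤ commutator Q := by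
    have := hN.eq_of_le (N ⊓ commutator Q) inf_le_left
      (hN.inv.inf (hP.isConjInvariant ⊤)) hb
    exact this ▸ inf_le_right
  obtain ⟨W, hWN, hW⟩ := exists_isMinInvariant (hNn.isConjInvariant (commutator Q)) hN.ne_bot
  -- Inner automorphisms of the abelian `W` are trivial, so `N` meets the centralizer of `Q'`
  -- nontrivially; minimality of `N` then puts all of `N` in it.
  have hWZ : W ≤ N ⊓ centralizer (commutator Q : Set Q) := by
    refine le_inf hWN fun x hx => mem_centralizer_iff.mpr fun g hg => ?_
    obtain ⟨w, hw, e⟩ := hinner W (hWN.trans hNP) hW g hg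
    have := e x hx
    rwa [hab w (hWN hw) x (hWN hx), mul_inv_cancel_right, mul_inv_eq_iff_eq_mul] at this
  have hZ := hN.eq_of_le (N ⊓ centralizer (commutator Q : Set Q)) inf_le_left
    (Normal.isConjInvariant inferInstance ⊤) fun h => hW.ne_bot (eq_bot_iff.mpr (h ▸ hWZ))
  intro g hg x hx
  rw [← hZ] at hx
  rw [mem_centralizer_iff.mp hx.2 g hg, mul_inv_cancel_right]

/-- A nonabelian minimal normal subgroup `N` becomes the derived subgroup modulo its centralizer,
if the derived subgroup induces inner automorphisms on its own minimal normal subgroups. -/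
theorem map_commutator_centralizer_eq {Q : Type*} [Group Q] [Finite Q] {N : Subgroup Q}
    (hN : IsMinInvariant ⊤ N) (hab : ¬ ∀ x ∈ N, ∀ y ∈ N, x * y = y * x)
    (hinner : ∀ W ≤ commutator Q, IsMinInvariant (commutator Q) W → ∀ g ∈ commutator Q,
      ∃ w ∈ W, ∀ x ∈ W, g * x * g⁻¹ = w * x * w⁻¹) {Q' : Type*} [Group Q'] {f : Q →* Q'}
    (hf : Function.Surjective f) (hker : f.ker = centralizer (N : Set Q)) :
    commutator Q' = N.map f := by
  have hNn : N.Normal := isConjInvariant_top_iff.mp hN.inv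
  have hP : (commutator Q).Normal := inferInstance
  have hNP : N ≤ commutator Q := by
    have h1 : ⁅N, N⁆ = N := by
      refine hN.eq_of_le _ (commutator_le_self N) (Normal.isConjInvariant inferInstance ⊤)
        fun hb => hab fun x hx y hy => ?_
      have : ⁅x, y⁆ ∈ (⊥ : Subgroup Q) := hb ▸ commutator_mem_commutator hx hy
      rwa [mem_bot, commutatorElement_eq_one_iff_mul_comm] at this
    rw [← h1]
    exact commutator_mono le_top le_top
  have hmap : commutator Q' = (commutator Q).map f := by
    rw [commutator_def, commutator_def, map_commutator, ← MonoidHom.range_eq_map,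
      MonoidHom.range_eq_top.mpr hf]
  rw [hmap]
  refine le_antisymm ?_ (map_mono hNP)
  rintro _ ⟨g, hg, rfl⟩
  obtain ⟨n, hn, e⟩ := hN.exists_conj_eq hP hNP (fun W hW => hinner W (hW.trans hNP)) g hg
  refine ⟨n, hn, ?_⟩
  -- `g` and `n` induce the same automorphism of `N`, so they agree modulo `C(N)`.
  have h1 : n⁻¹ * g ∈ f.ker := by
    rw [hker]
    refine mem_centralizer_iff.mpr fun x hx => ?_
    calc x * (n⁻¹ * g) = n⁻¹ * (n * x * n⁻¹) * g := by group
      _ = n⁻¹ * g * x := by rw [← e x hx]; group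
  rw [MonoidHom.mem_ker, map_mul, map_inv, inv_mul_eq_one] at h1
  exact h1

theorem isSimpleGroup_of_isMinInvariant {Q : Type*} [Group Q] {N : Subgroup Q}
    (h : IsMinInvariant N N) : IsSimpleGroup N where
  exists_pair_ne := ((nontrivial_iff_ne_bot N).mpr h.ne_bot).exists_pair_ne
  eq_bot_or_eq_top_of_normal L hL := by
    by_cases hb : L = ⊥
    · exact .inl hb
    right
    have hLi : IsConjInvariant N (L.map N.subtype) := by
      rintro g hg _ ⟨x, hx, rfl⟩
      exact ⟨⟨g, hg⟩ * x * ⟨g, hg⟩⁻¹, hL.conj_mem x hx _, rfl⟩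
    have := h.eq_of_le _ (map_subtype_le L) hLi
      fun h' => hb ((map_eq_bot_iff_of_injective L N.subtype_injective).mp h')
    apply map_injective N.subtype_injective
    rw [this, ← MonoidHom.range_eq_map, range_subtype]

/-- Minimality of `N` under a group `R` passes to and from an image faithful on `N`. -/
theorem Subgroup.isMinInvariant_map_iff {Q Q' : Type*} [Group Q] [Group Q'] (f : Q →* Q')
    {R N : Subgroup Q} (hR : IsConjInvariant R N) (hN : N ⊓ f.ker = ⊥) :
    IsMinInvariant (R.map f) (N.map f) ↔ IsMinInvariant R N := by
  have hbot : ∀ {L : Subgroup Q}, L ≤ N → L.map f = ⊥ → L = ⊥ := fun hL hb =>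
    eq_bot_iff.mpr (hN ▸ le_inf hL ((Subgroup.map_eq_bot_iff _).mp hb))
  have hinj : ∀ x ∈ N, ∀ y ∈ N, f x = f y → x = y := by
    intro x hx y hy h
    have : x⁻¹ * y ∈ N ⊓ f.ker := mem_inf.mpr ⟨N.mul_mem (N.inv_mem hx) hy, by
      rw [MonoidHom.mem_ker, map_mul, map_inv, h, inv_mul_cancel]⟩
    rw [hN, mem_bot, inv_mul_eq_one] at this
    exact this
  constructor
  · intro h
    refine ⟨fun hb => h.ne_bot (by rw [hb, Subgroup.map_bot]), hR, fun L hL hLi hLb => ?_⟩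
    have := h.eq_of_le (L.map f) (map_mono hL) (by
      rintro _ ⟨r, hr, rfl⟩ _ ⟨l, hl, rfl⟩
      exact ⟨_, hLi r hr l hl, by simp⟩) fun hb => hLb (hbot hL hb)
    refine le_antisymm hL fun x hx => ?_
    obtain ⟨l, hl, e⟩ := this.ge (mem_map_of_mem f hx)
    exact hinj l (hL hl) x hx e ▸ hl
  · intro h
    refine ⟨fun hb => h.ne_bot (hbot le_rfl hb), ?_, fun L hL hLi hLb => ?_⟩
    · rintro _ ⟨r, hr, rfl⟩ _ ⟨l, hl, rfl⟩
      exact ⟨_, hR r hr l hl, by simp⟩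
    · have hm : (L.comap f ⊓ N).map f = L := by
        refine le_antisymm ?_ fun x hx => ?_
        · rintro _ ⟨x, hx, rfl⟩
          exact hx.1
        · obtain ⟨n, hn, rfl⟩ := hL hx
          exact ⟨n, ⟨hx, hn⟩, rfl⟩
      have := h.eq_of_le (L.comap f ⊓ N) inf_le_right (fun r hr x hx =>
        ⟨by simpa using hLi (f r) ⟨r, hr, rfl⟩ (f x) hx.1, hR r hr x hx.2⟩)
        fun hb => hLb (by rw [← hm, hb, Subgroup.map_bot])
      rw [← hm, this]

/-- A mutually permutable product of `ca`-`F`-groups with quasinilpotent derived subgroup is a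
`ca`-`F`-group. -/
theorem IsMutuallyPermutableProduct.isCaGroup {F : FiniteGroupClass.{u}} (hF : F.IsSaturatedFormation)
    (hU : ∀ (A : Type u) [Group A] [Finite A], IsSupersoluble A → F.Mem A)
    {G : Type u} [Group G] [Finite G] {H K : Subgroup G}
    (hHK : IsMutuallyPermutableProduct H K)
    (hH : F.IsCaGroup H) (hK : F.IsCaGroup K)
    (hG : IsQuasinilpotent (_root_.commutator G)) :
    F.IsCaGroup G := by
  have hperm := MutuallyPermutes.of_isMutuallyPermutableProduct hHK
  have htop := hHK.sup_eq_top
  have hinner : ∀ {Q : Type u} [Group Q] (f : G →* Q), Function.Surjective f →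
      ∀ W ≤ commutator Q, IsMinInvariant (commutator Q) W → ∀ g ∈ commutator Q,
        ∃ w ∈ W, ∀ x ∈ W, g * x * g⁻¹ = w * x * w⁻¹ := by
    intro Q _ f hf W hW hWm
    rw [← range_comp_commutator_subtype hf] at hW hWm ⊢
    exact hG.exists_conj_eq _ hW hWm
  have htop' : ∀ {Q : Type u} [Group Q] (f : G →* Q), Function.Surjective f →
      H.map f ⊔ K.map f = ⊤ := by
    intro Q _ f hf
    rw [← Subgroup.map_sup, htop, ← MonoidHom.range_eq_map, MonoidHom.range_eq_top.mpr hf]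
  have hrange : ∀ {Q : Type u} [Group Q] (f : G →* Q) (A : Subgroup G),
      (f.comp A.subtype).range = A.map f := by
    intro Q _ f A
    rw [MonoidHom.range_comp, range_subtype]
  refine ⟨inferInstance, fun A B _ _ hc hna => ?_, fun A B _ _ hc hab => ?_⟩
  · let q := QuotientGroup.mk' B
    have hq : Function.Surjective q := QuotientGroup.mk'_surjective B
    set N := factorSubgroup A B
    have hN : IsMinInvariant ⊤ N := hc.isMinInvariant
    have hna' : ¬ ∀ x ∈ N, ∀ y ∈ N, x * y = y * x := fun h =>
      hna (isMulCommutative_iff.mpr fun x y => Subtype.ext (h x x.2 y y.2))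
    let r := QuotientGroup.mk' (centralizer (N : Set (G ⧸ B)))
    have hr : Function.Surjective r := QuotientGroup.mk'_surjective _
    have hker : r.ker = centralizer (N : Set (G ⧸ B)) := QuotientGroup.ker_mk' _
    -- `N` is nonabelian and minimal, so its centre is trivial and `N` embeds in the quotient by its
    -- centralizer; simplicity can be checked there.
    have hinf : N ⊓ r.ker = ⊥ := by
      rw [hker]
      by_contra hb
      have := hN.eq_of_le (N ⊓ centralizer (N : Set (G ⧸ B))) inf_le_left
        (Normal.isConjInvariant inferInstance ⊤) hb
      refine hna' fun x hx y hy => ?_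
      rw [← this] at hy
      exact mem_centralizer_iff.mp hy.2 x hx
    have hsocle : InnerSocle (N.map r) := by
      have hcomm := map_commutator_centralizer_eq hN hna' (hinner q hq) hr hker
      refine ⟨?_, fun h => hna' fun x hx y hy => ?_, hcomm, fun W hW hWm => ?_⟩
      · have := (isMinInvariant_map_iff r hN.inv hinf).mpr hN
        rwa [← MonoidHom.range_eq_map, MonoidHom.range_eq_top.mpr hr] at this
      · have h1 := h _ (mem_map_of_mem r hx) _ (mem_map_of_mem r hy)
        have h2 : ⁅x, y⁆ ∈ N ⊓ r.ker := by
          refine mem_inf.mpr ⟨commutator_le_self N (commutator_mem_commutator hx hy), ?_⟩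
          rw [MonoidHom.mem_ker, map_commutatorElement, commutatorElement_eq_one_iff_mul_comm, h1]
        rwa [hinf, mem_bot, commutatorElement_eq_one_iff_mul_comm] at h2
      · rw [← hcomm] at hW hWm ⊢
        exact hinner (r.comp q) (hr.comp hq) W hW hWm
    have hsimple := hsocle.simple (hperm.map (r.comp q)) (htop' _ (hr.comp hq))
      (hrange (r.comp q) H ▸ hH.hasSimpleMinInvariant _)
      (hrange (r.comp q) K ▸ hK.hasSimpleMinInvariant _)
    exact isSimpleGroup_of_isMinInvariant
      ((isMinInvariant_map_iff r (.of_le le_rfl) hinf).mp hsimple)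
  · let q := QuotientGroup.mk' B
    have hq : Function.Surjective q := QuotientGroup.mk'_surjective B
    have hN : IsMinInvariant ⊤ (factorSubgroup A B) := hc.isMinInvariant
    have hab' : ∀ x ∈ factorSubgroup A B, ∀ y ∈ factorSubgroup A B, x * y = y * x :=
      fun x hx y hy => congrArg Subtype.val (isMulCommutative_iff.mp hab ⟨x, hx⟩ ⟨y, hy⟩)
    have hca : ∀ C : Subgroup G, F.IsCaGroup C → ∀ M ≤ C.map q, ∀ hM : IsMinInvariant (C.map q) M,
        (∀ x ∈ M, ∀ y ∈ M, x * y = y * x) →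
        F.Mem (M ⋊[hM.inv.conjHom.range.subtype] hM.inv.conjHom.range) := by
      intro C hC
      rw [← hrange q C]
      exact fun M hM hMm hMab => hC.mem_of_isMinInvariant _ hM hMm hMab
    have h := mem_conjNormal_range_of_mutuallyPermutes hF hU hN hab'
      (commutator_centralizes_of_isMinInvariant hN hab' (hinner q hq)) (hperm.map q)
      (htop' q hq) (hca H hH) (hca K hK)
    have hr : (factorAction A B).range = (MulAut.conjNormal (H := factorSubgroup A B)).range := by
      apply le_antisymm
      · rintro _ ⟨g, rfl⟩
        exact ⟨q g, rfl⟩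
      · rintro _ ⟨g, rfl⟩
        obtain ⟨g, rfl⟩ := hq g
        exact ⟨g, rfl⟩
    rw [← hr] at h
    exact F.mem_of_mulEquiv _ _ (SemidirectProduct.kerLiftEquivRange (factorAction A B)).symm h

end Main

end Library

theorem theoremC (F : FiniteGroupClass.{u}) (hF : F.IsSaturatedFormation)
    (hU : ∀ (A : Type u) [Group A] [Finite A], IsSupersoluble A → F.Mem A)
    (G : Type u) [Group G] [Finite G] (H K : Subgroup G)
    (hHK : IsMutuallyPermutableProduct H K)
    (hH : F.IsCaGroup H) (hK : F.IsCaGroup K)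
    (hG : IsQuasinilpotent (commutator G)) :
    F.IsCaGroup G :=
  hHK.isCaGroup hF hU hH hK hG
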